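/- Let $(\widetilde M, g, J)$ be a Kähler manifold of real dimension $2m$ with Levi-Civita connection $\widetilde\nabla$, and let $M$ be a connected smooth surface (a $2$-dimensional manifold), immersed in $\widetilde M$ and endowed with the induced metric. Write $T_pM^\perp$ for the normal space of $M$ at $p$, and for a normal vector field $\xi$ along $M$ let $D_X\xi$ be the normal component of $\widetilde\nabla_X\xi$ (the normal connection) and $f\xi$ the normal component of $J\xi$. Let $\sigma(X,Y)$, the normal component of $\widetilde\nabla_XY$ for vector fields $X,Y$ tangent to $M$, be the second fundamental form, and let $H=\tfrac12\operatorname{tr}\sigma$ be the mean curvature vector. Assume that 1. $M$ is totally real: $J\,T_pM\subset T_pM^\perp$ for every $p\in M$; 2. the $f$-structure in the normal bundle is parallel: $D_X(f\xi)=f(D_X\xi)$ for all tangent vector fields $X$ and all normal vector fields $\xi$ (the case $f=0$, in which this is trivial, is included); 3. the mean curvature vector is parallel: $D_XH=0$ for all tangent vector fields $X$. Then $M$ is flat (the curvature tensor of the induced metric vanishes identically) or $M$ is minimal ($H=0$ identically). -/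

import Mathlib

open Bundle Set
open scoped Manifold ContDiff Topology

noncomputable section

namespace TotallyReal

/-! ## Covariant differentiation along a map, and the Levi-Civita connection -/

section Connection

variable {E : Type*} [NormedAddCommGroup E] [NormedSpace ℝ E]
  {N : Type*} [TopologicalSpace N] [ChartedSpace E N]

/-- A field of bilinear forms on the tangent spaces of a manifold `N` modelled on `E`. -/
abbrev FormField (E : Type*) [NormedAddCommGroup E] [NormedSpace ℝ E]
    (N : Type*) [TopologicalSpace N] [ChartedSpace E N] : Type _ :=
  ∀ q : N, TangentSpace 𝓘(ℝ, E) q →L[ℝ] TangentSpace 𝓘(ℝ, E) q →L[ℝ] ℝ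

/-- A vector field on `N`. -/
abbrev VField (E : Type*) [NormedAddCommGroup E] [NormedSpace ℝ E]
    (N : Type*) [TopologicalSpace N] [ChartedSpace E N] : Type _ :=
  ∀ q : N, TangentSpace 𝓘(ℝ, E) q

variable [IsManifold 𝓘(ℝ, E) ∞ N]

/-- Pull-back of a bilinear form by a linear map: `pullForm B L u v = B (L u) (L v)`. -/
def pullForm {F : Type*} [NormedAddCommGroup F] [NormedSpace ℝ F]
    (B : E →L[ℝ] E →L[ℝ] ℝ) (L : F →L[ℝ] E) : F →L[ℝ] F →L[ℝ] ℝ :=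
  B.bilinearComp L L

/-- For a field of bilinear forms `G` on the model space, the covector
`w ↦ (1/2) (∂_u G(v, w) + ∂_v G(u, w) - ∂_w G(u, v))` at the point `y`. -/
def koszulCovector (G : E → E →L[ℝ] E →L[ℝ] ℝ) (y u v : E) : E →L[ℝ] ℝ :=
  (2⁻¹ : ℝ) • (fderiv ℝ (fun z ↦ G z v) y u + fderiv ℝ (fun z ↦ G z u) y v
    - fderiv ℝ (fun z ↦ G z u v) y)

/-- Components of the form field `g` in the preferred chart at `q`, as a function on the model
space: `chartForm g q y (u, v)` is `g` at the point with coordinate `y`, evaluated on the vectors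
with coordinates `u` and `v`. -/
def chartForm (g : FormField E N) (q : N) (y : E) : E →L[ℝ] E →L[ℝ] ℝ :=
  let e := trivializationAt E (TangentSpace 𝓘(ℝ, E) : N → Type _) q
  let q' := (extChartAt 𝓘(ℝ, E) q).symm y
  pullForm (E := E) (F := E) (g q') (e.symmL ℝ q')

/-- The Christoffel symbol of `g` at `q` in the preferred chart at `q` (in which the tangent space
at `q` is the model space): `christoffel g q u v` is the vector `Γ` with
`2 g(Γ, w) = ∂_u g(v, w) + ∂_v g(u, w) - ∂_w g(u, v)` for all `w`. -/
def christoffel (g : FormField E N) (q : N) (u v : TangentSpace 𝓘(ℝ, E) q) :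
    TangentSpace 𝓘(ℝ, E) q :=
  (g q).inverse (koszulCovector (E := E) (chartForm g q) (extChartAt 𝓘(ℝ, E) q q) u v)

variable {F : Type*} [NormedAddCommGroup F] [NormedSpace ℝ F]
  {M : Type*} [TopologicalSpace M] [ChartedSpace F M]

/-- Covariant derivative, with respect to the Levi-Civita connection of `(N, g)`, of a vector field
`s` along the map `φ : M → N`, at `p` in the direction `v`. In the preferred chart of `N` at `φ p`
it is `ds(v) + Γ(dφ(v), s)`. -/
def covAlong (g : FormField E N) (φ : M → N) (s : ∀ p : M, TangentSpace 𝓘(ℝ, E) (φ p))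
    (p : M) (v : TangentSpace 𝓘(ℝ, F) p) : TangentSpace 𝓘(ℝ, E) (φ p) :=
  let e := trivializationAt E (TangentSpace 𝓘(ℝ, E) : N → Type _) (φ p)
  let sCoord : M → E := fun p' ↦ (e ⟨φ p', s p'⟩).2
  let ds : TangentSpace 𝓘(ℝ, E) (φ p) := mfderiv 𝓘(ℝ, F) 𝓘(ℝ, E) sCoord p v
  ds + christoffel g (φ p) (mfderiv 𝓘(ℝ, F) 𝓘(ℝ, E) φ p v) (s p)

/-- Smoothness of a vector field along the map `φ : M → N`. -/
def SmoothAlong (φ : M → N) (s : ∀ p : M, TangentSpace 𝓘(ℝ, E) (φ p)) : Prop :=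
  ContMDiff 𝓘(ℝ, F) (𝓘(ℝ, E).prod 𝓘(ℝ, E)) ∞
    (fun p ↦ (⟨φ p, s p⟩ : TotalSpace E (TangentSpace 𝓘(ℝ, E) : N → Type _)))

/-- Smooth vector fields on `N`. -/
def SmoothField (X : VField E N) : Prop := SmoothAlong (F := E) (fun q : N ↦ q) X

/-- The Levi-Civita connection `∇_v X` at the point `q` of `(N, g)`. -/
def leviCivita (g : FormField E N) (X : VField E N) (q : N) (v : TangentSpace 𝓘(ℝ, E) q) :
    TangentSpace 𝓘(ℝ, E) q :=
  covAlong g (fun q : N ↦ q) X q v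

/-- The curvature `R(X, Y)Z = ∇_X ∇_Y Z - ∇_Y ∇_X Z - ∇_[X, Y] Z`. -/
def curvature (g : FormField E N) (X Y Z : VField E N) (q : N) : TangentSpace 𝓘(ℝ, E) q :=
  leviCivita g (fun q' ↦ leviCivita g Z q' (Y q')) q (X q)
    - leviCivita g (fun q' ↦ leviCivita g Z q' (X q')) q (Y q)
    - leviCivita g Z q (VectorField.mlieBracket 𝓘(ℝ, E) X Y q)

/-- `(N, g)` is flat: its curvature tensor vanishes. -/
def IsFlat (g : FormField E N) : Prop :=
  ∀ X Y Z : VField E N, SmoothField X → SmoothField Y → SmoothField Z →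
    ∀ q, curvature g X Y Z q = 0

end Connection

/-! ## Kähler manifolds -/

/-- A Kähler structure on a smooth manifold `N`: a smooth Riemannian metric `g` and a smooth field
`J` of endomorphisms with `J² = -1`, orthogonal with respect to `g`, and parallel with respect to
the Levi-Civita connection: `∇_v (J X) = J (∇_v X)`. Since the connection is torsion-free, the last
condition contains the integrability of `J`. -/
structure KahlerStructure (E : Type*) [NormedAddCommGroup E] [NormedSpace ℝ E]
    (N : Type*) [TopologicalSpace N] [ChartedSpace E N] [IsManifold 𝓘(ℝ, E) ∞ N] where
  metric : ContMDiffRiemannianMetric 𝓘(ℝ, E) ∞ E (TangentSpace 𝓘(ℝ, E) : N → Type _)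
  J : ∀ q : N, TangentSpace 𝓘(ℝ, E) q →L[ℝ] TangentSpace 𝓘(ℝ, E) q
  smooth_J : ContMDiff 𝓘(ℝ, E) (𝓘(ℝ, E).prod 𝓘(ℝ, E →L[ℝ] E)) ∞
    (fun q ↦ TotalSpace.mk' (E →L[ℝ] E)
      (E := fun q : N ↦ TangentSpace 𝓘(ℝ, E) q →L[ℝ] TangentSpace 𝓘(ℝ, E) q) q (J q))
  J_J : ∀ (q : N) (v : TangentSpace 𝓘(ℝ, E) q), J q (J q v) = -v
  metric_J : ∀ (q : N) (v w : TangentSpace 𝓘(ℝ, E) q),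
    metric.inner q (J q v) (J q w) = metric.inner q v w
  parallel_J : ∀ X : VField E N, SmoothField X → ∀ (q : N) (v : TangentSpace 𝓘(ℝ, E) q),
    leviCivita metric.inner (fun q' ↦ J q' (X q')) q v = J q (leviCivita metric.inner X q v)

/-! ## Submanifolds -/

section Submanifold

variable {E : Type*} [NormedAddCommGroup E] [NormedSpace ℝ E]
  {N : Type*} [TopologicalSpace N] [ChartedSpace E N] [IsManifold 𝓘(ℝ, E) ∞ N]
  {F : Type*} [NormedAddCommGroup F] [NormedSpace ℝ F]
  {M : Type*} [TopologicalSpace M] [ChartedSpace F M]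

/-- The differential of `φ : M → N` at `p`. -/
abbrev differential (E F : Type*) [NormedAddCommGroup E] [NormedSpace ℝ E]
    [NormedAddCommGroup F] [NormedSpace ℝ F]
    {N : Type*} [TopologicalSpace N] [ChartedSpace E N]
    {M : Type*} [TopologicalSpace M] [ChartedSpace F M] (φ : M → N) (p : M) :
    TangentSpace 𝓘(ℝ, F) p →L[ℝ] TangentSpace 𝓘(ℝ, E) (φ p) :=
  mfderiv 𝓘(ℝ, F) 𝓘(ℝ, E) φ p

/-- `φ` is a smooth immersion, i.e. `M` is an (immersed) submanifold of `N` through `φ`. -/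
def IsSmoothImmersion (E F : Type*) [NormedAddCommGroup E] [NormedSpace ℝ E]
    [NormedAddCommGroup F] [NormedSpace ℝ F]
    {N : Type*} [TopologicalSpace N] [ChartedSpace E N]
    {M : Type*} [TopologicalSpace M] [ChartedSpace F M] (φ : M → N) : Prop :=
  ContMDiff 𝓘(ℝ, F) 𝓘(ℝ, E) ∞ φ ∧ ∀ p, Function.Injective (differential E F φ p)

/-- The metric on `M` induced by `φ : M → (N, g)`. -/
def inducedMetric (g : FormField E N) (φ : M → N) : FormField F M :=
  fun p ↦ pullForm (E := E) (F := F) (g (φ p)) (differential E F φ p)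

/-- The tangential component of `u`, as an element of the tangent space of `M`: the vector `t` with
`g(dφ(t), dφ(w)) = g(u, dφ(w))` for all `w`. -/
def tangentPart (F : Type*) [NormedAddCommGroup F] [NormedSpace ℝ F]
    {M : Type*} [TopologicalSpace M] [ChartedSpace F M]
    (g : FormField E N) (φ : M → N) (p : M) (u : TangentSpace 𝓘(ℝ, E) (φ p)) :
    TangentSpace 𝓘(ℝ, F) p :=
  (inducedMetric g φ p).inverse ((g (φ p) u).comp (differential E F φ p))

/-- The normal component of `u`. -/
def normalPart (F : Type*) [NormedAddCommGroup F] [NormedSpace ℝ F]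
    {M : Type*} [TopologicalSpace M] [ChartedSpace F M]
    (g : FormField E N) (φ : M → N) (p : M) (u : TangentSpace 𝓘(ℝ, E) (φ p)) :
    TangentSpace 𝓘(ℝ, E) (φ p) :=
  u - differential E F φ p (tangentPart F g φ p u)

/-- `ξ` is a smooth normal vector field of the submanifold. -/
def IsNormalField (F : Type*) [NormedAddCommGroup F] [NormedSpace ℝ F]
    {M : Type*} [TopologicalSpace M] [ChartedSpace F M]
    (g : FormField E N) (φ : M → N) (ξ : ∀ p : M, TangentSpace 𝓘(ℝ, E) (φ p)) : Prop :=
  SmoothAlong (F := F) φ ξ ∧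
    ∀ (p : M) (w : TangentSpace 𝓘(ℝ, F) p), g (φ p) (ξ p) (differential E F φ p w) = 0

/-- The normal connection: `D_v ξ` is the normal component of the ambient derivative of `ξ`. -/
def normalCov (g : FormField E N) (φ : M → N) (ξ : ∀ p : M, TangentSpace 𝓘(ℝ, E) (φ p))
    (p : M) (v : TangentSpace 𝓘(ℝ, F) p) : TangentSpace 𝓘(ℝ, E) (φ p) :=
  normalPart F g φ p (covAlong g φ ξ p v)

/-- `ξ` is parallel in the normal bundle. -/
def IsNormalParallel (F : Type*) [NormedAddCommGroup F] [NormedSpace ℝ F]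
    {M : Type*} [TopologicalSpace M] [ChartedSpace F M]
    (g : FormField E N) (φ : M → N) (ξ : ∀ p : M, TangentSpace 𝓘(ℝ, E) (φ p)) : Prop :=
  ∀ (p : M) (v : TangentSpace 𝓘(ℝ, F) p), normalCov g φ ξ p v = 0

variable [IsManifold 𝓘(ℝ, F) ∞ M]

/-- The second fundamental form `σ(v, w)` at `p`: the normal component of the ambient derivative in
the direction `v` of `dφ(W)`, where `W` is a vector field on `M`, smooth near `p`, with
`W p = w`. -/
def secondFundamentalForm (g : FormField E N) (φ : M → N) (p : M)
    (v w : TangentSpace 𝓘(ℝ, F) p) : TangentSpace 𝓘(ℝ, E) (φ p) :=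
  normalPart F g φ p
    (covAlong g φ (fun p' ↦ differential E F φ p' (FiberBundle.extend F w p')) p v)

/-- The mean curvature vector `H = (1/n) tr σ`, with `n = dim M`. In a basis `b` of the tangent
space, `tr σ = ∑ i j, g^{ij} σ(b_i, b_j)`, where `∑ j, g^{ij} b_j` is the vector that corresponds
under the metric to the `i`-th coordinate functional. -/
def meanCurvature (F : Type*) [NormedAddCommGroup F] [NormedSpace ℝ F] [FiniteDimensional ℝ F]
    {M : Type*} [TopologicalSpace M] [ChartedSpace F M] [IsManifold 𝓘(ℝ, F) ∞ M]
    (g : FormField E N) (φ : M → N) (p : M) : TangentSpace 𝓘(ℝ, E) (φ p) :=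
  let b := Module.finBasis ℝ F
  ((Module.finrank ℝ F : ℝ)⁻¹) • ∑ i, secondFundamentalForm g φ p (b i)
    ((inducedMetric (F := F) g φ p).inverse (b.coord i).toContinuousLinearMap)

/-- The submanifold is minimal: its mean curvature vector vanishes identically. -/
def IsMinimal (F : Type*) [NormedAddCommGroup F] [NormedSpace ℝ F] [FiniteDimensional ℝ F]
    {M : Type*} [TopologicalSpace M] [ChartedSpace F M] [IsManifold 𝓘(ℝ, F) ∞ M]
    (g : FormField E N) (φ : M → N) : Prop :=
  ∀ p : M, meanCurvature F g φ p = 0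

end Submanifold

/-! ## Submanifolds of Kähler manifolds -/

namespace KahlerStructure

variable {E : Type*} [NormedAddCommGroup E] [NormedSpace ℝ E]
  {N : Type*} [TopologicalSpace N] [ChartedSpace E N] [IsManifold 𝓘(ℝ, E) ∞ N]

/-- The underlying form field of the metric. -/
abbrev g (K : KahlerStructure E N) : FormField E N := K.metric.inner

/-- `M` is totally real: `J` maps the tangent spaces of `M` into the normal spaces. -/
def IsTotallyReal (K : KahlerStructure E N) (F : Type*) [NormedAddCommGroup F] [NormedSpace ℝ F]
    {M : Type*} [TopologicalSpace M] [ChartedSpace F M] (φ : M → N) : Prop :=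
  ∀ (p : M) (v w : TangentSpace 𝓘(ℝ, F) p),
    K.g (φ p) (K.J (φ p) (differential E F φ p v)) (differential E F φ p w) = 0

/-- `f ξ` is the normal component of `J ξ`. -/
def f (K : KahlerStructure E N) (F : Type*) [NormedAddCommGroup F] [NormedSpace ℝ F]
    {M : Type*} [TopologicalSpace M] [ChartedSpace F M] (φ : M → N) (p : M)
    (ξ : TangentSpace 𝓘(ℝ, E) (φ p)) : TangentSpace 𝓘(ℝ, E) (φ p) :=
  normalPart F K.g φ p (K.J (φ p) ξ)

/-- The `f`-structure in the normal bundle is parallel: `D_v (f ξ) = f (D_v ξ)` for all smooth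
normal vector fields `ξ`. -/
def HasParallelF (K : KahlerStructure E N) (F : Type*) [NormedAddCommGroup F] [NormedSpace ℝ F]
    {M : Type*} [TopologicalSpace M] [ChartedSpace F M] (φ : M → N) : Prop :=
  ∀ ξ : (∀ p : M, TangentSpace 𝓘(ℝ, E) (φ p)), IsNormalField F K.g φ ξ →
    ∀ (p : M) (v : TangentSpace 𝓘(ℝ, F) p),
      normalCov K.g φ (fun p' ↦ K.f F φ p' (ξ p')) p v = K.f F φ p (normalCov K.g φ ξ p v)

end KahlerStructure

end TotallyReal

end

/-!
Since `J dφ(Z)` is normal and `f (J dφ(Z)) = 0`, differentiating along `v` and using that `f` is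
parallel gives `f (f (σ(v, Z))) = 0`; as `f` is skew on the normal space, `f σ = 0`. Hence
`f H = 0`, so `H = J dφ(X)` for a tangent field `X`, and `D H = J dφ(∇X)`, so that `X` is parallel
for the induced metric. A parallel field has constant length, and on a surface a nonzero one
completes, after scaling, to a parallel orthonormal frame near each point, which makes the curvature
vanish.

The Levi-Civita derivative at a point is computed in the preferred chart of that point, so even its
smooth dependence on the point needs an argument: the Gauss formula, applied to charts as
isometries onto their targets, shows that one fixed chart computes it at all nearby points.
-/

noncomputable section

namespace TotallyReal

/-! ## The Koszul formula on the model space -/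

section Model

variable {D E F V : Type*} [NormedAddCommGroup D] [NormedSpace ℝ D]
  [NormedAddCommGroup E] [NormedSpace ℝ E] [NormedAddCommGroup F] [NormedSpace ℝ F]
  [NormedAddCommGroup V] [NormedSpace ℝ V]

-- Without these shortcuts instance search times out on spaces of bilinear forms.
instance : NormedAddCommGroup (E →L[ℝ] F →L[ℝ] ℝ) := ContinuousLinearMap.toNormedAddCommGroup

instance : NormedSpace ℝ (E →L[ℝ] F →L[ℝ] ℝ) := ContinuousLinearMap.toNormedSpace

theorem isInvertible_of_pos [FiniteDimensional ℝ E] {B : E →L[ℝ] E →L[ℝ] ℝ}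
    (hB : ∀ v, v ≠ 0 → 0 < B v v) : B.IsInvertible := by
  have hinj : Function.Injective B := (injective_iff_map_eq_zero B).2 fun v hv ↦ by
    by_contra hne
    simpa [hv] using hB v hne
  have hfin : Module.finrank ℝ E = Module.finrank ℝ (E →L[ℝ] ℝ) := by
    rw [← (LinearMap.toContinuousLinearMap (𝕜 := ℝ) (E := E) (F' := ℝ)).finrank_eq]
    exact Subspace.dual_finrank_eq.symm
  exact ⟨(LinearEquiv.ofInjectiveOfFinrankEq (B : E →ₗ[ℝ] E →L[ℝ] ℝ) hinj
    hfin).toContinuousLinearEquiv, rfl⟩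

theorem hasFDerivAt_apply_apply {G : D → E →L[ℝ] F →L[ℝ] V} {y : D}
    (hG : DifferentiableAt ℝ G y) (u : E) (v : F) :
    HasFDerivAt (fun z ↦ G z u v) (((fderiv ℝ G y).flip u).flip v) y := by
  simpa using (hG.hasFDerivAt.clm_apply (hasFDerivAt_const u y)).clm_apply (hasFDerivAt_const v y)

section Koszul

variable {G : E → E →L[ℝ] E →L[ℝ] ℝ} {y : E}

theorem koszulCovector_apply (hG : DifferentiableAt ℝ G y) (u v w : E) :
    koszulCovector G y u v w =
      2⁻¹ * (fderiv ℝ G y u v w + fderiv ℝ G y v u w - fderiv ℝ G y w u v) := by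
  have hG_apply (a b : E) : fderiv ℝ (fun z ↦ G z a) y b = fderiv ℝ G y b a := by
    simp [fderiv_clm_apply hG (differentiableAt_const a)]
  simp [koszulCovector, hG_apply, (hasFDerivAt_apply_apply hG u v).fderiv]

theorem fderiv_form_symm (hG : DifferentiableAt ℝ G y)
    (hsymm : ∀ᶠ z in 𝓝 y, ∀ v w, G z v w = G z w v) (u v w : E) :
    fderiv ℝ G y u v w = fderiv ℝ G y u w v := by
  have hswap := (hasFDerivAt_apply_apply hG v w).unique
    ((hasFDerivAt_apply_apply hG w v).congr_of_eventuallyEq (hsymm.mono fun z hz ↦ hz v w))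
  simpa using congr($hswap u)

theorem koszulCovector_comm (hG : DifferentiableAt ℝ G y)
    (hsymm : ∀ᶠ z in 𝓝 y, ∀ v w, G z v w = G z w v) (u v : E) :
    koszulCovector G y u v = koszulCovector G y v u := by
  ext w
  rw [koszulCovector_apply hG, koszulCovector_apply hG, fderiv_form_symm hG hsymm w u v]
  ring

theorem koszulCovector_add_koszulCovector (hG : DifferentiableAt ℝ G y)
    (hsymm : ∀ᶠ z in 𝓝 y, ∀ v w, G z v w = G z w v) (u v w : E) :
    koszulCovector G y u v w + koszulCovector G y u w v = fderiv ℝ G y u v w := by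
  rw [koszulCovector_apply hG, koszulCovector_apply hG, fderiv_form_symm hG hsymm v u w,
    fderiv_form_symm hG hsymm w u v, fderiv_form_symm hG hsymm u w v]
  ring

theorem koszulCovector_add_left (hG : DifferentiableAt ℝ G y) (u u' v : E) :
    koszulCovector G y (u + u') v = koszulCovector G y u v + koszulCovector G y u' v := by
  ext w
  simp only [koszulCovector_apply hG, add_apply, map_add]
  ring

theorem koszulCovector_smul_left (hG : DifferentiableAt ℝ G y) (c : ℝ) (u v : E) :
    koszulCovector G y (c • u) v = c • koszulCovector G y u v := by
  ext w
  simp only [koszulCovector_apply hG, smul_apply, map_smul, smul_eq_mul]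
  ring

end Koszul

section Pullback

variable {G : E → E →L[ℝ] E →L[ℝ] ℝ} {G' : F → F →L[ℝ] F →L[ℝ] ℝ} {Φ : F → E} {x : F}

theorem differentiableAt_fderiv_of_contDiffAt_two (hΦ : ContDiffAt ℝ 2 Φ x) :
    DifferentiableAt ℝ (fderiv ℝ Φ) x :=
  (hΦ.fderiv_right (m := 1) (by norm_num)).differentiableAt (by norm_num)

theorem differentiableAt_pullback (hΦ : ContDiffAt ℝ 2 Φ x) (hG : DifferentiableAt ℝ G (Φ x))
    (hG' : ∀ᶠ z in 𝓝 x, ∀ v w, G' z v w = G (Φ z) (fderiv ℝ Φ z v) (fderiv ℝ Φ z w)) :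
    DifferentiableAt ℝ G' x := by
  have hdΦ : DifferentiableAt ℝ (fderiv ℝ Φ) x := differentiableAt_fderiv_of_contDiffAt_two hΦ
  have hleft : DifferentiableAt ℝ (fun z ↦ (G (Φ z)).comp (fderiv ℝ Φ z)) x :=
    (DifferentiableAt.comp (g := G) x hG (hΦ.differentiableAt (by norm_num))).clm_comp hdΦ
  have hright : DifferentiableAt ℝ
      (fun z ↦ ((G (Φ z)).comp (fderiv ℝ Φ z)).flip.comp (fderiv ℝ Φ z)) x :=
    (DifferentiableAt.comp x (ContinuousLinearMap.flipₗᵢ ℝ F E ℝ).differentiableAt hleft :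
      DifferentiableAt ℝ (fun z ↦ ((G (Φ z)).comp (fderiv ℝ Φ z)).flip) x).clm_comp hdΦ
  have hboth : DifferentiableAt ℝ
      (fun z ↦ (G (Φ z)).bilinearComp (fderiv ℝ Φ z) (fderiv ℝ Φ z)) x :=
    DifferentiableAt.comp x (ContinuousLinearMap.flipₗᵢ ℝ F F ℝ).differentiableAt hright
  exact hboth.congr_of_eventuallyEq (hG'.mono fun z hz ↦ by ext v w; exact hz v w)

theorem fderiv_pullback_apply (hΦ : ContDiffAt ℝ 2 Φ x) (hG : DifferentiableAt ℝ G (Φ x))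
    (hG' : ∀ᶠ z in 𝓝 x, ∀ v w, G' z v w = G (Φ z) (fderiv ℝ Φ z v) (fderiv ℝ Φ z w))
    (u v w : F) :
    fderiv ℝ G' x u v w =
      fderiv ℝ G (Φ x) (fderiv ℝ Φ x u) (fderiv ℝ Φ x v) (fderiv ℝ Φ x w)
      + G (Φ x) (fderiv ℝ (fderiv ℝ Φ) x u v) (fderiv ℝ Φ x w)
      + G (Φ x) (fderiv ℝ Φ x v) (fderiv ℝ (fderiv ℝ Φ) x u w) := by
  have hdΦ := (differentiableAt_fderiv_of_contDiffAt_two hΦ).hasFDerivAt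
  have hGΦ : HasFDerivAt (fun z ↦ G (Φ z)) ((fderiv ℝ G (Φ x)).comp (fderiv ℝ Φ x)) x :=
    HasFDerivAt.comp (g := G) x hG.hasFDerivAt (hΦ.differentiableAt (by norm_num)).hasFDerivAt
  have hproduct := (hGΦ.clm_apply (hdΦ.clm_apply (hasFDerivAt_const v x))).clm_apply
    (hdΦ.clm_apply (hasFDerivAt_const w x))
  have hunique := (hasFDerivAt_apply_apply (differentiableAt_pullback hΦ hG hG') v w).unique
    (hproduct.congr_of_eventuallyEq (hG'.mono fun z hz ↦ hz v w))
  have hexpand := congr($hunique u)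
  simp only [ContinuousLinearMap.flip_apply, ContinuousLinearMap.comp_zero, zero_add,
    ContinuousLinearMap.flip_add, add_apply, ContinuousLinearMap.comp_apply] at hexpand
  linarith

theorem koszulCovector_pullback (hΦ : ContDiffAt ℝ 2 Φ x) (hG : DifferentiableAt ℝ G (Φ x))
    (hsymm : ∀ v w, G (Φ x) v w = G (Φ x) w v)
    (hG' : ∀ᶠ z in 𝓝 x, ∀ v w, G' z v w = G (Φ z) (fderiv ℝ Φ z v) (fderiv ℝ Φ z w))
    (u v w : F) :
    koszulCovector G' x u v w =
      koszulCovector G (Φ x) (fderiv ℝ Φ x u) (fderiv ℝ Φ x v) (fderiv ℝ Φ x w)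
        + G (Φ x) (fderiv ℝ (fderiv ℝ Φ) x u v) (fderiv ℝ Φ x w) := by
  have hd2 : ∀ a b, fderiv ℝ (fderiv ℝ Φ) x a b = fderiv ℝ (fderiv ℝ Φ) x b a :=
    hΦ.isSymmSndFDerivAt (by simp)
  simp only [koszulCovector_apply (differentiableAt_pullback hΦ hG hG'), koszulCovector_apply hG,
    fderiv_pullback_apply hΦ hG hG']
  rw [hd2 v u, hd2 w u, hd2 w v, hsymm (fderiv ℝ Φ x v) (fderiv ℝ (fderiv ℝ Φ) x u w),
    hsymm (fderiv ℝ Φ x u) (fderiv ℝ (fderiv ℝ Φ) x v w)]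
  ring

end Pullback

end Model

/-! ## Tangent vectors and metrics in charts -/

section Charts

variable {E : Type*} [NormedAddCommGroup E] [NormedSpace ℝ E]
  {N : Type*} [TopologicalSpace N] [ChartedSpace E N]
  {F : Type*} [NormedAddCommGroup F] [NormedSpace ℝ F]
  {M : Type*} [TopologicalSpace M] [ChartedSpace F M]
  {V : Type*} [NormedAddCommGroup V] [NormedSpace ℝ V]
  {W : Type*} [NormedAddCommGroup W] [NormedSpace ℝ W]

theorem mvfderiv_clm_apply {A : M → V →L[ℝ] W} {u : M → V} {p : M}
    (hA : MDifferentiableAt 𝓘(ℝ, F) 𝓘(ℝ, V →L[ℝ] W) A p)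
    (hu : MDifferentiableAt 𝓘(ℝ, F) 𝓘(ℝ, V) u p) (v : TangentSpace 𝓘(ℝ, F) p) :
    mvfderiv 𝓘(ℝ, F) (fun p' ↦ A p' (u p')) p v =
      A p (mvfderiv 𝓘(ℝ, F) u p v) + mvfderiv 𝓘(ℝ, F) A p v (u p) := by
  have hderiv := hA.hasMFDerivAt.2.clm_apply hu.hasMFDerivAt.2
  simp only [writtenInExtChartAt, extChartAt_model_space_eq_id, Function.comp_apply,
    PartialEquiv.refl_coe, id_eq, extChartAt_to_inv] at hderiv
  have hproduct : HasMFDerivAt 𝓘(ℝ, F) 𝓘(ℝ, W) (fun p' ↦ A p' (u p')) p _ :=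
    ⟨hA.continuousAt.clm_apply hu.continuousAt, hderiv⟩
  exact congr($hproduct.mfderiv v)

variable [IsManifold 𝓘(ℝ, E) ∞ N]

theorem mdifferentiableAt_comp_extChartAt {D : E → V} {φ : M → N} {p : M}
    (hD : DifferentiableAt ℝ D (extChartAt 𝓘(ℝ, E) (φ p) (φ p)))
    (hφ : MDifferentiableAt 𝓘(ℝ, F) 𝓘(ℝ, E) φ p) :
    MDifferentiableAt 𝓘(ℝ, F) 𝓘(ℝ, V) (fun p' ↦ D (extChartAt 𝓘(ℝ, E) (φ p) (φ p'))) p :=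
  hD.mdifferentiableAt.comp p
    ((mdifferentiableAt_extChartAt (mem_chart_source E (φ p))).comp p hφ)

theorem mvfderiv_comp_extChartAt {D : E → V} {φ : M → N} {p : M}
    (hD : DifferentiableAt ℝ D (extChartAt 𝓘(ℝ, E) (φ p) (φ p)))
    (hφ : MDifferentiableAt 𝓘(ℝ, F) 𝓘(ℝ, E) φ p) (v : TangentSpace 𝓘(ℝ, F) p) :
    mvfderiv 𝓘(ℝ, F) (fun p' ↦ D (extChartAt 𝓘(ℝ, E) (φ p) (φ p'))) p v =
      fderiv ℝ D (extChartAt 𝓘(ℝ, E) (φ p) (φ p)) (differential E F φ p v) := by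
  have hchart : MDifferentiableAt 𝓘(ℝ, E) 𝓘(ℝ, E) (extChartAt 𝓘(ℝ, E) (φ p)) (φ p) :=
    mdifferentiableAt_extChartAt (mem_chart_source E (φ p))
  have hcomp := mfderiv_comp_apply (g := D) p hD.mdifferentiableAt (hchart.comp p hφ) v
  rw [mfderiv_eq_fderiv, mfderiv_comp_apply p hchart hφ] at hcomp
  refine hcomp.trans ?_
  congr 1
  exact congr($(mfderiv_extChartAt_self (I := 𝓘(ℝ, E)) (x := φ p)) (differential E F φ p v))

/-- The coordinates of a tangent vector at `q` in the preferred chart at `q₀`; meaningful only for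
`q` in the domain of that chart. -/
def coord (q₀ : N) {q : N} (u : TangentSpace 𝓘(ℝ, E) q) : E :=
  (trivializationAt E (TangentSpace 𝓘(ℝ, E) : N → Type _) q₀ ⟨q, u⟩).2

/-- The tangent vector at `q` with given coordinates in the preferred chart at `q₀`, inverse to
`coord` on the domain of that chart. -/
def ofCoord (q₀ q : N) (a : E) : TangentSpace 𝓘(ℝ, E) q :=
  (trivializationAt E (TangentSpace 𝓘(ℝ, E) : N → Type _) q₀).symmL ℝ q a

theorem mem_baseSet_iff_mem_extChartAt_source {q₀ q : N} :
    q ∈ (trivializationAt E (TangentSpace 𝓘(ℝ, E) : N → Type _) q₀).baseSet ↔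
      q ∈ (extChartAt 𝓘(ℝ, E) q₀).source := by
  rw [TangentBundle.trivializationAt_baseSet, extChartAt_source]

section Coord

variable {q₀ q : N} (hq : q ∈ (extChartAt 𝓘(ℝ, E) q₀).source)

include hq

theorem coord_eq_continuousLinearMapAt (u : TangentSpace 𝓘(ℝ, E) q) :
    coord q₀ u = (trivializationAt E (TangentSpace 𝓘(ℝ, E) : N → Type _)
      q₀).continuousLinearMapAt ℝ q u := by
  rw [Trivialization.continuousLinearMapAt_apply, Trivialization.linearMapAt_apply,
    if_pos (mem_baseSet_iff_mem_extChartAt_source.2 hq)]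
  rfl

theorem coord_eq_mvfderiv (u : TangentSpace 𝓘(ℝ, E) q) :
    coord q₀ u = mvfderiv 𝓘(ℝ, E) (extChartAt 𝓘(ℝ, E) q₀) q u := by
  rw [coord_eq_continuousLinearMapAt hq,
    TangentBundle.continuousLinearMapAt_trivializationAt (by rwa [extChartAt_source] at hq)]
  rfl

theorem coord_ofCoord (a : E) : coord q₀ (ofCoord q₀ q a) = a := by
  rw [coord_eq_continuousLinearMapAt hq]
  exact Trivialization.continuousLinearMapAt_symmL _
    (mem_baseSet_iff_mem_extChartAt_source.2 hq) a

theorem ofCoord_coord (u : TangentSpace 𝓘(ℝ, E) q) : ofCoord q₀ q (coord q₀ u) = u := by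
  rw [coord_eq_continuousLinearMapAt hq]
  exact Trivialization.symmL_continuousLinearMapAt _
    (mem_baseSet_iff_mem_extChartAt_source.2 hq) u

theorem coord_add (u w : TangentSpace 𝓘(ℝ, E) q) :
    coord q₀ (u + w) = coord q₀ u + coord q₀ w := by
  simp only [coord_eq_continuousLinearMapAt hq, map_add]

theorem coord_smul (c : ℝ) (u : TangentSpace 𝓘(ℝ, E) q) :
    coord q₀ (c • u) = c • coord q₀ u := by
  simp only [coord_eq_continuousLinearMapAt hq, map_smul]

theorem chartForm_coord (g : FormField E N) (u w : TangentSpace 𝓘(ℝ, E) q) :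
    chartForm g q₀ (extChartAt 𝓘(ℝ, E) q₀ q) (coord q₀ u) (coord q₀ w) = g q u w := by
  have transport : ∀ q', q' = q →
      g q' (ofCoord q₀ q' (coord q₀ u)) (ofCoord q₀ q' (coord q₀ w)) = g q u w := by
    rintro q' rfl
    rw [ofCoord_coord hq, ofCoord_coord hq]
  exact transport _ ((extChartAt 𝓘(ℝ, E) q₀).left_inv hq)

theorem mvfderiv_eq_fderiv_coord {f : N → V} (hf : MDifferentiableAt 𝓘(ℝ, E) 𝓘(ℝ, V) f q)
    (u : TangentSpace 𝓘(ℝ, E) q) :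
    mvfderiv 𝓘(ℝ, E) f q u =
      fderiv ℝ (fun y ↦ f ((extChartAt 𝓘(ℝ, E) q₀).symm y)) (extChartAt 𝓘(ℝ, E) q₀ q)
        (coord q₀ u) := by
  set c := extChartAt 𝓘(ℝ, E) q₀
  have hc_symm : MDifferentiableAt 𝓘(ℝ, E) 𝓘(ℝ, E) c.symm (c q) := by
    have := mdifferentiableWithinAt_extChartAt_symm (I := 𝓘(ℝ, E)) (c.map_source hq)
    rwa [modelWithCornersSelf_coe, range_id, mdifferentiableWithinAt_univ] at this
  have hf_symm : MDifferentiableAt 𝓘(ℝ, E) 𝓘(ℝ, V) (fun y ↦ f (c.symm y)) (c q) :=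
    MDifferentiableAt.comp (I' := 𝓘(ℝ, E)) (g := f) (c q) (by rwa [c.left_inv hq]) hc_symm
  have heq : f =ᶠ[𝓝 q] fun z ↦ f (c.symm (c z)) := by
    filter_upwards [extChartAt_source_mem_nhds' (I := 𝓘(ℝ, E)) hq] with z hz
    rw [c.left_inv hz]
  rw [coord_eq_mvfderiv hq, ← mfderiv_eq_fderiv]
  exact congr($(heq.mfderiv_eq) u).trans (mfderiv_comp_apply (g := fun y ↦ f (c.symm y)) q hf_symm
    (mdifferentiableAt_extChartAt (by rwa [extChartAt_source] at hq)) u)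

end Coord

theorem coord_self {q : N} (u : TangentSpace 𝓘(ℝ, E) q) : coord q u = u := by
  rw [coord_eq_mvfderiv (mem_extChartAt_source q)]
  exact congr($(mfderiv_extChartAt_self (I := 𝓘(ℝ, E)) (x := q)) u)

theorem ofCoord_self (q : N) (a : E) : ofCoord q q a = a := by
  rw [← coord_self (ofCoord q q a)]
  exact coord_ofCoord (mem_extChartAt_source q) a

theorem chartForm_apply (g : FormField E N) (q₀ : N) (y a b : E) :
    chartForm g q₀ y a b = g ((extChartAt 𝓘(ℝ, E) q₀).symm y)
      (ofCoord q₀ ((extChartAt 𝓘(ℝ, E) q₀).symm y) a)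
      (ofCoord q₀ ((extChartAt 𝓘(ℝ, E) q₀).symm y) b) :=
  rfl

theorem chartForm_self (g : FormField E N) (q : N) (u w : TangentSpace 𝓘(ℝ, E) q) :
    chartForm g q (extChartAt 𝓘(ℝ, E) q q) u w = g q u w := by
  simpa only [coord_self] using chartForm_coord (mem_extChartAt_source (I := 𝓘(ℝ, E)) q) g u w

theorem coord_differential {E' : Type*} [NormedAddCommGroup E'] [NormedSpace ℝ E']
    {N' : Type*} [TopologicalSpace N'] [ChartedSpace E' N'] [IsManifold 𝓘(ℝ, E') ∞ N']
    {Φ : N → N'} {q₀ q : N} (hq : q ∈ (extChartAt 𝓘(ℝ, E) q₀).source)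
    (hΦq : Φ q ∈ (extChartAt 𝓘(ℝ, E') (Φ q₀)).source)
    (hΦ : MDifferentiableAt 𝓘(ℝ, E) 𝓘(ℝ, E') Φ q) (u : TangentSpace 𝓘(ℝ, E) q) :
    coord (Φ q₀) (differential E' E Φ q u) =
      fderiv ℝ (writtenInExtChartAt 𝓘(ℝ, E) 𝓘(ℝ, E') q₀ Φ) (extChartAt 𝓘(ℝ, E) q₀ q)
        (coord q₀ u) := by
  have hchart : MDifferentiableAt 𝓘(ℝ, E') 𝓘(ℝ, E') (extChartAt 𝓘(ℝ, E') (Φ q₀)) (Φ q) :=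
    mdifferentiableAt_extChartAt (by rwa [extChartAt_source] at hΦq)
  rw [coord_eq_mvfderiv hΦq]
  exact (mfderiv_comp_apply q hchart hΦ u).symm.trans
    (mvfderiv_eq_fderiv_coord hq (hchart.comp q hΦ) u)

end Charts

/-! ## The covariant derivative along a map -/

section CovAlong

variable {E : Type*} [NormedAddCommGroup E] [NormedSpace ℝ E]
  {N : Type*} [TopologicalSpace N] [ChartedSpace E N]
  {F : Type*} [NormedAddCommGroup F] [NormedSpace ℝ F]
  {M : Type*} [TopologicalSpace M] [ChartedSpace F M]

/-- The form `g q` as a form on the model space. -/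
def formAt (g : FormField E N) (q : N) : E →L[ℝ] E →L[ℝ] ℝ := g q

theorem eventually_mem_extChartAt_source {φ : M → N} {p : M} (hφ : ContinuousAt φ p) :
    ∀ᶠ p' in 𝓝 p, φ p' ∈ (extChartAt 𝓘(ℝ, E) (φ p)).source :=
  hφ.preimage_mem_nhds (extChartAt_source_mem_nhds (φ p))

variable [IsManifold 𝓘(ℝ, E) ∞ N]

/-- The conditions on the form field `g` at `q` under which its Christoffel symbol at `q` is the
Levi-Civita one: `g` is symmetric, and nondegenerate and differentiable at `q`. -/
structure IsRegularAt (g : FormField E N) (q : N) : Prop where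
  symm : ∀ (q' : N) (v w : TangentSpace 𝓘(ℝ, E) q'), g q' v w = g q' w v
  invertible : (formAt g q).IsInvertible
  differentiableAt : DifferentiableAt ℝ (chartForm g q) (extChartAt 𝓘(ℝ, E) q q)

/-- Differentiability at `p` of a vector field `s` along the map `φ : M → N`. -/
def DiffAlongAt (F : Type*) [NormedAddCommGroup F] [NormedSpace ℝ F]
    {M : Type*} [TopologicalSpace M] [ChartedSpace F M]
    (φ : M → N) (s : ∀ p : M, TangentSpace 𝓘(ℝ, E) (φ p)) (p : M) : Prop :=
  MDifferentiableAt 𝓘(ℝ, F) (𝓘(ℝ, E).prod 𝓘(ℝ, E))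
    (fun p ↦ (⟨φ p, s p⟩ : TotalSpace E (TangentSpace 𝓘(ℝ, E) : N → Type _))) p

theorem diffAlongAt_iff {φ : M → N} {s : ∀ p : M, TangentSpace 𝓘(ℝ, E) (φ p)} {p : M} :
    DiffAlongAt F φ s p ↔ MDifferentiableAt 𝓘(ℝ, F) 𝓘(ℝ, E) φ p ∧
      MDifferentiableAt 𝓘(ℝ, F) 𝓘(ℝ, E) (fun p' ↦ coord (φ p) (s p')) p :=
  mdifferentiableAt_totalSpace _ _

/-- The derivative at `p` of the coordinates of `s` in the preferred chart at `φ p`. -/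
def derivCoord (φ : M → N) (s : ∀ p : M, TangentSpace 𝓘(ℝ, E) (φ p)) (p : M)
    (v : TangentSpace 𝓘(ℝ, F) p) : TangentSpace 𝓘(ℝ, E) (φ p) :=
  mvfderiv 𝓘(ℝ, F) (fun p' ↦ coord (φ p) (s p')) p v

theorem covAlong_eq (g : FormField E N) (φ : M → N) (s : ∀ p : M, TangentSpace 𝓘(ℝ, E) (φ p))
    (p : M) (v : TangentSpace 𝓘(ℝ, F) p) :
    covAlong g φ s p v =
      derivCoord φ s p v + christoffel g (φ p) (differential E F φ p v) (s p) :=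
  rfl

section Christoffel

variable {g : FormField E N} {q : N} (hg : IsRegularAt g q)

include hg

theorem IsRegularAt.eventually_chartForm_symm :
    ∀ᶠ y in 𝓝 (extChartAt 𝓘(ℝ, E) q q), ∀ a b : E,
      chartForm g q y a b = chartForm g q y b a :=
  Filter.Eventually.of_forall fun y a b ↦ by
    rw [chartForm_apply, chartForm_apply]
    exact hg.symm _ _ _

theorem metric_christoffel (u v w : TangentSpace 𝓘(ℝ, E) q) :
    g q (christoffel g q u v) w =
      koszulCovector (E := E) (chartForm g q) (extChartAt 𝓘(ℝ, E) q q) u v w :=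
  congr($(hg.invertible.self_apply_inverse
    (koszulCovector (chartForm g q) (extChartAt 𝓘(ℝ, E) q q) u v)) w)

theorem christoffel_comm (u v : TangentSpace 𝓘(ℝ, E) q) :
    christoffel g q u v = christoffel g q v u :=
  congr((formAt g q).inverse
    $(koszulCovector_comm hg.differentiableAt hg.eventually_chartForm_symm u v))

theorem christoffel_add_left (u u' v : TangentSpace 𝓘(ℝ, E) q) :
    christoffel g q (u + u') v = christoffel g q u v + christoffel g q u' v :=
  congr((formAt g q).inverse $(koszulCovector_add_left hg.differentiableAt u u' v)).trans
    (map_add _ _ _)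

theorem christoffel_smul_left (c : ℝ) (u v : TangentSpace 𝓘(ℝ, E) q) :
    christoffel g q (c • u) v = c • christoffel g q u v :=
  congr((formAt g q).inverse $(koszulCovector_smul_left hg.differentiableAt c u v)).trans
    (map_smul _ _ _)

theorem christoffel_add_right (u v v' : TangentSpace 𝓘(ℝ, E) q) :
    christoffel g q u (v + v') = christoffel g q u v + christoffel g q u v' := by
  rw [christoffel_comm hg, christoffel_add_left hg, christoffel_comm hg v, christoffel_comm hg v']

theorem christoffel_smul_right (c : ℝ) (u v : TangentSpace 𝓘(ℝ, E) q) :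
    christoffel g q u (c • v) = c • christoffel g q u v := by
  rw [christoffel_comm hg, christoffel_smul_left hg, christoffel_comm hg v]

end Christoffel

section Rules

variable {φ : M → N} {s t : ∀ p : M, TangentSpace 𝓘(ℝ, E) (φ p)} {p : M} {a : M → ℝ}

theorem eventuallyEq_coord_add (hφ : ContinuousAt φ p) :
    (fun p' ↦ coord (φ p) (s p' + t p')) =ᶠ[𝓝 p]
      (fun p' ↦ coord (φ p) (s p')) + fun p' ↦ coord (φ p) (t p') :=
  (eventually_mem_extChartAt_source hφ).mono fun _ hp' ↦ coord_add hp' _ _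

theorem eventuallyEq_coord_smul (hφ : ContinuousAt φ p) :
    (fun p' ↦ coord (φ p) (a p' • s p')) =ᶠ[𝓝 p] a • fun p' ↦ coord (φ p) (s p') :=
  (eventually_mem_extChartAt_source hφ).mono fun _ hp' ↦ coord_smul hp' _ _

theorem DiffAlongAt.continuousAt (hs : DiffAlongAt F φ s p) : ContinuousAt φ p :=
  (diffAlongAt_iff.1 hs).1.continuousAt

theorem DiffAlongAt.add (hs : DiffAlongAt F φ s p) (ht : DiffAlongAt F φ t p) :
    DiffAlongAt F φ (fun p' ↦ s p' + t p') p := by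
  have hφ := hs.continuousAt
  rw [diffAlongAt_iff] at hs ht ⊢
  exact ⟨hs.1, (hs.2.add ht.2).congr_of_eventuallyEq (eventuallyEq_coord_add hφ)⟩

theorem DiffAlongAt.smul (ha : MDifferentiableAt 𝓘(ℝ, F) 𝓘(ℝ, ℝ) a p)
    (hs : DiffAlongAt F φ s p) : DiffAlongAt F φ (fun p' ↦ a p' • s p') p := by
  have hφ := hs.continuousAt
  rw [diffAlongAt_iff] at hs ⊢
  exact ⟨hs.1, (ha.smul hs.2).congr_of_eventuallyEq (eventuallyEq_coord_smul hφ)⟩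

theorem derivCoord_add (hs : DiffAlongAt F φ s p) (ht : DiffAlongAt F φ t p)
    (v : TangentSpace 𝓘(ℝ, F) p) :
    derivCoord φ (fun p' ↦ s p' + t p') p v = derivCoord φ s p v + derivCoord φ t p v := by
  have hcoord := (eventuallyEq_coord_add (s := s) (t := t) hs.continuousAt).mfderiv_eq.trans
    (mvfderiv_add (diffAlongAt_iff.1 hs).2 (diffAlongAt_iff.1 ht).2)
  exact congr($hcoord v)

theorem derivCoord_smul (ha : MDifferentiableAt 𝓘(ℝ, F) 𝓘(ℝ, ℝ) a p) (hs : DiffAlongAt F φ s p)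
    (v : TangentSpace 𝓘(ℝ, F) p) :
    derivCoord φ (fun p' ↦ a p' • s p') p v =
      a p • derivCoord φ s p v + mvfderiv 𝓘(ℝ, F) a p v • s p := by
  have hcoord := (eventuallyEq_coord_smul (s := s) (a := a) hs.continuousAt).mfderiv_eq.trans
    (mvfderiv_smul ha (diffAlongAt_iff.1 hs).2)
  rw [← coord_self (s p)]
  exact congr($hcoord v)

variable {g : FormField E N}

theorem covAlong_congr (hst : ∀ᶠ p' in 𝓝 p, s p' = t p') (v : TangentSpace 𝓘(ℝ, F) p) :
    covAlong g φ s p v = covAlong g φ t p v := by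
  have hcoord : (fun p' ↦ coord (φ p) (s p')) =ᶠ[𝓝 p] fun p' ↦ coord (φ p) (t p') :=
    hst.mono fun p' hp' ↦ by simp only [hp']
  have hderiv : derivCoord φ s p v = derivCoord φ t p v := congr($hcoord.mfderiv_eq v)
  rw [covAlong_eq, covAlong_eq, hst.self_of_nhds, hderiv]

theorem covAlong_add (hg : IsRegularAt g (φ p)) (hs : DiffAlongAt F φ s p)
    (ht : DiffAlongAt F φ t p) (v : TangentSpace 𝓘(ℝ, F) p) :
    covAlong g φ (fun p' ↦ s p' + t p') p v = covAlong g φ s p v + covAlong g φ t p v := by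
  rw [covAlong_eq, covAlong_eq, covAlong_eq, christoffel_add_right hg, derivCoord_add hs ht]
  exact add_add_add_comm _ _ _ _

theorem covAlong_smul (hg : IsRegularAt g (φ p)) (ha : MDifferentiableAt 𝓘(ℝ, F) 𝓘(ℝ, ℝ) a p)
    (hs : DiffAlongAt F φ s p) (v : TangentSpace 𝓘(ℝ, F) p) :
    covAlong g φ (fun p' ↦ a p' • s p') p v =
      a p • covAlong g φ s p v + mvfderiv 𝓘(ℝ, F) a p v • s p := by
  rw [covAlong_eq, covAlong_eq, christoffel_smul_right hg, derivCoord_smul ha hs, smul_add]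
  exact add_right_comm _ _ _

theorem metric_eventuallyEq_chartForm (g : FormField E N) (hφ : ContinuousAt φ p) :
    (fun p' ↦ g (φ p') (s p') (t p')) =ᶠ[𝓝 p] fun p' ↦
      chartForm g (φ p) (extChartAt 𝓘(ℝ, E) (φ p) (φ p')) (coord (φ p) (s p'))
        (coord (φ p) (t p')) :=
  (eventually_mem_extChartAt_source hφ).mono fun _ hp' ↦ (chartForm_coord hp' g _ _).symm

theorem mvfderiv_metric (hg : IsRegularAt g (φ p)) (hs : DiffAlongAt F φ s p)
    (ht : DiffAlongAt F φ t p) (v : TangentSpace 𝓘(ℝ, F) p) :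
    mvfderiv 𝓘(ℝ, F) (fun p' ↦ g (φ p') (s p') (t p')) p v =
      g (φ p) (covAlong g φ s p v) (t p) + g (φ p) (s p) (covAlong g φ t p v) := by
  have hs' := diffAlongAt_iff.1 hs
  have hform := mdifferentiableAt_comp_extChartAt hg.differentiableAt hs'.1
  have hproduct := mvfderiv_clm_apply (hform.clm_apply hs'.2) (diffAlongAt_iff.1 ht).2 v
  rw [mvfderiv_clm_apply hform hs'.2 v, mvfderiv_comp_extChartAt hg.differentiableAt hs'.1,
    coord_self, coord_self] at hproduct
  have hchart : mvfderiv 𝓘(ℝ, F) (fun p' ↦ g (φ p') (s p') (t p')) p = mvfderiv 𝓘(ℝ, F) _ p :=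
    (metric_eventuallyEq_chartForm g hs.continuousAt).mfderiv_eq
  have hΓ : fderiv ℝ (chartForm g (φ p)) (extChartAt 𝓘(ℝ, E) (φ p) (φ p))
      (differential E F φ p v) (s p) (t p) =
      g (φ p) (christoffel g (φ p) (differential E F φ p v) (s p)) (t p) +
        g (φ p) (s p) (christoffel g (φ p) (differential E F φ p v) (t p)) := by
    rw [metric_christoffel hg, hg.symm _ (s p), metric_christoffel hg]
    exact (koszulCovector_add_koszulCovector hg.differentiableAt hg.eventually_chartForm_symm
      _ _ _).symm
  have hs_self : chartForm g (φ p) (extChartAt 𝓘(ℝ, E) (φ p) (φ p)) (derivCoord φ s p v) (t p) =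
      g (φ p) (derivCoord φ s p v) (t p) := chartForm_self _ _ _ _
  have ht_self : chartForm g (φ p) (extChartAt 𝓘(ℝ, E) (φ p) (φ p)) (s p) (derivCoord φ t p v) =
      g (φ p) (s p) (derivCoord φ t p v) := chartForm_self _ _ _ _
  calc mvfderiv 𝓘(ℝ, F) (fun p' ↦ g (φ p') (s p') (t p')) p v
    _ = g (φ p) (s p) (derivCoord φ t p v) + (g (φ p) (derivCoord φ s p v) (t p) +
          fderiv ℝ (chartForm g (φ p)) (extChartAt 𝓘(ℝ, E) (φ p) (φ p))
            (differential E F φ p v) (s p) (t p)) := by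
      rw [hchart, ← hs_self, ← ht_self]
      exact hproduct
    _ = _ := by
      rw [hΓ, covAlong_eq, covAlong_eq, map_add, map_add, add_apply]
      ring

end Rules

end CovAlong

/-! ## The Gauss formula -/

section Gauss

variable {E : Type*} [NormedAddCommGroup E] [NormedSpace ℝ E]
  {N : Type*} [TopologicalSpace N] [ChartedSpace E N]
  {E' : Type*} [NormedAddCommGroup E'] [NormedSpace ℝ E']
  {N' : Type*} [TopologicalSpace N'] [ChartedSpace E' N']
  {F : Type*} [NormedAddCommGroup F] [NormedSpace ℝ F]
  {M : Type*} [TopologicalSpace M] [ChartedSpace F M]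
  {Φ : N → N'} {q : N} {φ : M → N} {s : ∀ p : M, TangentSpace 𝓘(ℝ, E) (φ p)} {p : M}

theorem contDiffAt_writtenInExtChartAt (hΦ : ContMDiffAt 𝓘(ℝ, E) 𝓘(ℝ, E') 2 Φ q) :
    ContDiffAt ℝ 2 (writtenInExtChartAt 𝓘(ℝ, E) 𝓘(ℝ, E') q Φ) (extChartAt 𝓘(ℝ, E) q q) := by
  have hchart := (contMDiffAt_iff.1 hΦ).2
  rwa [modelWithCornersSelf_coe, range_id, contDiffWithinAt_univ] at hchart

theorem fderiv_writtenInExtChartAt (hΦ : MDifferentiableAt 𝓘(ℝ, E) 𝓘(ℝ, E') Φ q)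
    (u : TangentSpace 𝓘(ℝ, E) q) :
    fderiv ℝ (writtenInExtChartAt 𝓘(ℝ, E) 𝓘(ℝ, E') q Φ) (extChartAt 𝓘(ℝ, E) q q) u =
      differential E' E Φ q u := by
  have hderiv := hΦ.mfderiv
  rw [modelWithCornersSelf_coe, range_id, fderivWithin_univ] at hderiv
  exact congr($hderiv.symm u)

theorem writtenInExtChartAt_self :
    writtenInExtChartAt 𝓘(ℝ, E) 𝓘(ℝ, E') q Φ (extChartAt 𝓘(ℝ, E) q q) =
      extChartAt 𝓘(ℝ, E') (Φ q) (Φ q) := by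
  simp only [writtenInExtChartAt, Function.comp_apply, extChartAt_to_inv]

/-- The second derivative of `Φ` in the preferred charts at `q` and `Φ q`. -/
def secondDeriv (E E' : Type*) [NormedAddCommGroup E] [NormedSpace ℝ E]
    [NormedAddCommGroup E'] [NormedSpace ℝ E'] {N : Type*} [TopologicalSpace N] [ChartedSpace E N]
    {N' : Type*} [TopologicalSpace N'] [ChartedSpace E' N'] (Φ : N → N') (q : N)
    (u w : TangentSpace 𝓘(ℝ, E) q) : TangentSpace 𝓘(ℝ, E') (Φ q) :=
  fderiv ℝ (fderiv ℝ (writtenInExtChartAt 𝓘(ℝ, E) 𝓘(ℝ, E') q Φ)) (extChartAt 𝓘(ℝ, E) q q) u w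

theorem secondDeriv_comm (hΦ : ContMDiffAt 𝓘(ℝ, E) 𝓘(ℝ, E') 2 Φ q)
    (u w : TangentSpace 𝓘(ℝ, E) q) : secondDeriv E E' Φ q u w = secondDeriv E E' Φ q w u :=
  (contDiffAt_writtenInExtChartAt hΦ).isSymmSndFDerivAt (by simp) u w

theorem secondDeriv_add_left (u u' w : TangentSpace 𝓘(ℝ, E) q) :
    secondDeriv E E' Φ q (u + u') w = secondDeriv E E' Φ q u w + secondDeriv E E' Φ q u' w :=
  congr($(map_add (fderiv ℝ (fderiv ℝ (writtenInExtChartAt 𝓘(ℝ, E) 𝓘(ℝ, E') q Φ))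
    (extChartAt 𝓘(ℝ, E) q q)) u u') w)

theorem secondDeriv_smul_left (c : ℝ) (u w : TangentSpace 𝓘(ℝ, E) q) :
    secondDeriv E E' Φ q (c • u) w = c • secondDeriv E E' Φ q u w :=
  congr($(map_smul (fderiv ℝ (fderiv ℝ (writtenInExtChartAt 𝓘(ℝ, E) 𝓘(ℝ, E') q Φ))
    (extChartAt 𝓘(ℝ, E) q q)) c u) w)

variable [IsManifold 𝓘(ℝ, E) ∞ N]

theorem mdifferentiableAt_fderiv_writtenInExtChartAt
    (hΦ : ContMDiffAt 𝓘(ℝ, E) 𝓘(ℝ, E') 2 Φ (φ p))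
    (hφ : MDifferentiableAt 𝓘(ℝ, F) 𝓘(ℝ, E) φ p) :
    MDifferentiableAt 𝓘(ℝ, F) 𝓘(ℝ, E →L[ℝ] E') (fun p' ↦
      fderiv ℝ (writtenInExtChartAt 𝓘(ℝ, E) 𝓘(ℝ, E') (φ p) Φ)
        (extChartAt 𝓘(ℝ, E) (φ p) (φ p'))) p :=
  mdifferentiableAt_comp_extChartAt
    (differentiableAt_fderiv_of_contDiffAt_two (contDiffAt_writtenInExtChartAt hΦ)) hφ

variable [IsManifold 𝓘(ℝ, E') ∞ N']

theorem eventually_mdifferentiableAt (hΦ : ContMDiffAt 𝓘(ℝ, E) 𝓘(ℝ, E') 2 Φ q) :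
    ∀ᶠ q' in 𝓝 q, MDifferentiableAt 𝓘(ℝ, E) 𝓘(ℝ, E') Φ q' :=
  ((contMDiffAt_iff_contMDiffAt_nhds (by simp)).1 hΦ).mono fun _ h ↦
    h.mdifferentiableAt (by norm_num)

theorem eventuallyEq_coord_differential (hΦ : ContMDiffAt 𝓘(ℝ, E) 𝓘(ℝ, E') 2 Φ (φ p))
    (hφ : ContinuousAt φ p) :
    (fun p' ↦ coord (Φ (φ p)) (differential E' E Φ (φ p') (s p'))) =ᶠ[𝓝 p] fun p' ↦
      fderiv ℝ (writtenInExtChartAt 𝓘(ℝ, E) 𝓘(ℝ, E') (φ p) Φ) (extChartAt 𝓘(ℝ, E) (φ p) (φ p'))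
        (coord (φ p) (s p')) := by
  filter_upwards [eventually_mem_extChartAt_source (E := E) hφ,
    eventually_mem_extChartAt_source (E := E') (ContinuousAt.comp (g := Φ) hΦ.continuousAt hφ),
    hφ.eventually (eventually_mdifferentiableAt hΦ)] with p' hφp' hΦp' hdiff
  exact coord_differential hφp' hΦp' hdiff _

theorem derivCoord_differential (hΦ : ContMDiffAt 𝓘(ℝ, E) 𝓘(ℝ, E') 2 Φ (φ p))
    (hs : DiffAlongAt F φ s p) (v : TangentSpace 𝓘(ℝ, F) p) :
    derivCoord (fun p' ↦ Φ (φ p')) (fun p' ↦ differential E' E Φ (φ p') (s p')) p v =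
      differential E' E Φ (φ p) (derivCoord φ s p v)
        + secondDeriv E E' Φ (φ p) (differential E F φ p v) (s p) := by
  have hs' := diffAlongAt_iff.1 hs
  have hchart : derivCoord (fun p' ↦ Φ (φ p')) (fun p' ↦ differential E' E Φ (φ p') (s p')) p v =
      mvfderiv 𝓘(ℝ, F) (F := E') _ p v :=
    congr($((eventuallyEq_coord_differential hΦ hs.continuousAt).mfderiv_eq) v)
  rw [hchart, mvfderiv_clm_apply (mdifferentiableAt_fderiv_writtenInExtChartAt hΦ hs'.1) hs'.2 v,
    mvfderiv_comp_extChartAt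
      (differentiableAt_fderiv_of_contDiffAt_two (contDiffAt_writtenInExtChartAt hΦ)) hs'.1,
    coord_self, ← fderiv_writtenInExtChartAt (hΦ.mdifferentiableAt (by norm_num))]
  rfl

theorem chartForm_inducedMetric (g : FormField E' N') (hΦ : ContMDiffAt 𝓘(ℝ, E) 𝓘(ℝ, E') 2 Φ q) :
    ∀ᶠ z in 𝓝 (extChartAt 𝓘(ℝ, E) q q), ∀ a b : E,
      chartForm (inducedMetric g Φ) q z a b =
        chartForm g (Φ q) (writtenInExtChartAt 𝓘(ℝ, E) 𝓘(ℝ, E') q Φ z)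
          (fderiv ℝ (writtenInExtChartAt 𝓘(ℝ, E) 𝓘(ℝ, E') q Φ) z a)
          (fderiv ℝ (writtenInExtChartAt 𝓘(ℝ, E) 𝓘(ℝ, E') q Φ) z b) := by
  have hsymm : Filter.Tendsto (extChartAt 𝓘(ℝ, E) q).symm (𝓝 (extChartAt 𝓘(ℝ, E) q q)) (𝓝 q) := by
    simpa only [ContinuousAt, extChartAt_to_inv] using continuousAt_extChartAt_symm (I := 𝓘(ℝ, E)) q
  filter_upwards [hsymm.eventually (eventually_mdifferentiableAt hΦ),
    hsymm.eventually (eventually_mem_extChartAt_source (E := E') hΦ.continuousAt),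
    extChartAt_target_mem_nhds (I := 𝓘(ℝ, E)) q] with z hdiff hΦz hz a b
  have hz_source := (extChartAt 𝓘(ℝ, E) q).map_target hz
  have hcoord (a : E) : coord (Φ q) (differential E' E Φ ((extChartAt 𝓘(ℝ, E) q).symm z)
      (ofCoord q ((extChartAt 𝓘(ℝ, E) q).symm z) a)) =
      fderiv ℝ (writtenInExtChartAt 𝓘(ℝ, E) 𝓘(ℝ, E') q Φ) z a := by
    rw [coord_differential hz_source hΦz hdiff, coord_ofCoord hz_source,
      (extChartAt 𝓘(ℝ, E) q).right_inv hz]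
  rw [← hcoord, ← hcoord]
  exact (chartForm_coord hΦz g _ _).symm

theorem IsRegularAt.induced {g : FormField E' N'} (hg : IsRegularAt g (Φ q))
    (hΦ : ContMDiffAt 𝓘(ℝ, E) 𝓘(ℝ, E') 2 Φ q)
    (hi : (formAt (inducedMetric (F := E) g Φ) q).IsInvertible) :
    IsRegularAt (inducedMetric (F := E) g Φ) q where
  symm q' _ _ := hg.symm (Φ q') _ _
  invertible := hi
  differentiableAt := differentiableAt_pullback (contDiffAt_writtenInExtChartAt hΦ)
    (by simpa only [writtenInExtChartAt_self] using hg.differentiableAt)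
    (chartForm_inducedMetric g hΦ)

/-- The second fundamental form of `Φ` as the difference of the ambient and the induced connections,
`∇²Φ(u, w) = ∂²Φ(u, w) + Γ(dΦ u, dΦ w) - dΦ(Γ'(u, w))` in the preferred charts. -/
def gaussForm (E : Type*) [NormedAddCommGroup E] [NormedSpace ℝ E]
    {N : Type*} [TopologicalSpace N] [ChartedSpace E N] [IsManifold 𝓘(ℝ, E) ∞ N]
    (g : FormField E' N') (Φ : N → N') (q : N) (u w : TangentSpace 𝓘(ℝ, E) q) :
    TangentSpace 𝓘(ℝ, E') (Φ q) :=
  secondDeriv E E' Φ q u w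
    + christoffel g (Φ q) (differential E' E Φ q u) (differential E' E Φ q w)
    - differential E' E Φ q (christoffel (inducedMetric g Φ) q u w)

theorem covAlong_differential (g : FormField E' N')
    (hΦ : ContMDiffAt 𝓘(ℝ, E) 𝓘(ℝ, E') 2 Φ (φ p)) (hs : DiffAlongAt F φ s p)
    (v : TangentSpace 𝓘(ℝ, F) p) :
    covAlong g (fun p' ↦ Φ (φ p')) (fun p' ↦ differential E' E Φ (φ p') (s p')) p v =
      differential E' E Φ (φ p) (covAlong (inducedMetric g Φ) φ s p v)
        + gaussForm E g Φ (φ p) (differential E F φ p v) (s p) := by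
  have hchain : differential E' F (fun p' ↦ Φ (φ p')) p v =
      differential E' E Φ (φ p) (differential E F φ p v) :=
    mfderiv_comp_apply (g := Φ) p (hΦ.mdifferentiableAt (by norm_num)) (diffAlongAt_iff.1 hs).1 v
  rw [covAlong_eq, derivCoord_differential hΦ hs, covAlong_eq, map_add, gaussForm, hchain]
  abel

section GaussForm

variable {g : FormField E' N'} (hg : IsRegularAt g (Φ q))
  (hi : (formAt (inducedMetric (F := E) g Φ) q).IsInvertible)
  (hΦ : ContMDiffAt 𝓘(ℝ, E) 𝓘(ℝ, E') 2 Φ q)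

include hg hi hΦ

theorem metric_gaussForm (u v w : TangentSpace 𝓘(ℝ, E) q) :
    g (Φ q) (gaussForm E g Φ q u v) (differential E' E Φ q w) = 0 := by
  have hkoszul := koszulCovector_pullback (contDiffAt_writtenInExtChartAt hΦ)
    (G := chartForm g (Φ q)) (by simpa only [writtenInExtChartAt_self] using hg.differentiableAt)
    (by simpa only [writtenInExtChartAt_self] using hg.eventually_chartForm_symm.self_of_nhds)
    (chartForm_inducedMetric g hΦ) u v w
  simp only [writtenInExtChartAt_self,
    fderiv_writtenInExtChartAt (hΦ.mdifferentiableAt (by norm_num))] at hkoszul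
  have hinduced : g (Φ q) (differential E' E Φ q (christoffel (inducedMetric g Φ) q u v))
      (differential E' E Φ q w) = _ := metric_christoffel (hg.induced hΦ hi) u v w
  have hsecond : g (Φ q) (secondDeriv E E' Φ q u v) (differential E' E Φ q w) =
      chartForm g (Φ q) (extChartAt 𝓘(ℝ, E') (Φ q) (Φ q)) (secondDeriv E E' Φ q u v)
        (differential E' E Φ q w) := (chartForm_self _ _ _ _).symm
  rw [gaussForm, map_sub, map_add, sub_apply, add_apply, hinduced, metric_christoffel hg, hsecond,
    sub_eq_zero, add_comm]
  exact hkoszul.symm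

theorem gaussForm_comm (u v : TangentSpace 𝓘(ℝ, E) q) :
    gaussForm E g Φ q u v = gaussForm E g Φ q v u := by
  rw [gaussForm, gaussForm, secondDeriv_comm hΦ, christoffel_comm hg,
    christoffel_comm (hg.induced hΦ hi)]

theorem gaussForm_add_left (u u' v : TangentSpace 𝓘(ℝ, E) q) :
    gaussForm E g Φ q (u + u') v = gaussForm E g Φ q u v + gaussForm E g Φ q u' v := by
  rw [gaussForm, gaussForm, gaussForm, secondDeriv_add_left, map_add, christoffel_add_left hg,
    christoffel_add_left (hg.induced hΦ hi), map_add]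
  abel

theorem gaussForm_smul_left (c : ℝ) (u v : TangentSpace 𝓘(ℝ, E) q) :
    gaussForm E g Φ q (c • u) v = c • gaussForm E g Φ q u v := by
  rw [gaussForm, gaussForm, secondDeriv_smul_left, map_smul, christoffel_smul_left hg,
    christoffel_smul_left (hg.induced hΦ hi), map_smul, smul_sub, smul_add]

end GaussForm

end Gauss

/-! ## Smooth vector fields along maps -/

section Smooth

variable {E : Type*} [NormedAddCommGroup E] [NormedSpace ℝ E]
  {N : Type*} [TopologicalSpace N] [ChartedSpace E N] [IsManifold 𝓘(ℝ, E) ∞ N]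
  {F : Type*} [NormedAddCommGroup F] [NormedSpace ℝ F]
  {M : Type*} [TopologicalSpace M] [ChartedSpace F M]

/-- Smoothness at `p` of a vector field `s` along the map `φ : M → N`. -/
def SmoothAlongAt (F : Type*) [NormedAddCommGroup F] [NormedSpace ℝ F]
    {M : Type*} [TopologicalSpace M] [ChartedSpace F M]
    (φ : M → N) (s : ∀ p : M, TangentSpace 𝓘(ℝ, E) (φ p)) (p : M) : Prop :=
  ContMDiffAt 𝓘(ℝ, F) (𝓘(ℝ, E).prod 𝓘(ℝ, E)) ∞
    (fun p ↦ (⟨φ p, s p⟩ : TotalSpace E (TangentSpace 𝓘(ℝ, E) : N → Type _))) p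

/-- Smoothness of a vector field on `N` at `q`. -/
abbrev SmoothFieldAt (X : VField E N) (q : N) : Prop :=
  SmoothAlongAt E (fun q : N ↦ q) X q

section Rules

variable {φ : M → N} {s t : ∀ p : M, TangentSpace 𝓘(ℝ, E) (φ p)} {p : M}

theorem smoothAlongAt_iff {q₀ : N} (hp : φ p ∈ (extChartAt 𝓘(ℝ, E) q₀).source) :
    SmoothAlongAt F φ s p ↔ ContMDiffAt 𝓘(ℝ, F) 𝓘(ℝ, E) ∞ φ p ∧
      ContMDiffAt 𝓘(ℝ, F) 𝓘(ℝ, E) ∞ (fun p' ↦ coord q₀ (s p')) p :=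
  Trivialization.contMDiffAt_iff
    (e := trivializationAt E (TangentSpace 𝓘(ℝ, E) : N → Type _) q₀)
    (f := fun p ↦ (⟨φ p, s p⟩ : TotalSpace E (TangentSpace 𝓘(ℝ, E) : N → Type _)))
    ((Trivialization.mem_source _).2 (mem_baseSet_iff_mem_extChartAt_source.2 hp))

theorem smoothAlongAt_iff_coord_self :
    SmoothAlongAt F φ s p ↔ ContMDiffAt 𝓘(ℝ, F) 𝓘(ℝ, E) ∞ φ p ∧
      ContMDiffAt 𝓘(ℝ, F) 𝓘(ℝ, E) ∞ (fun p' ↦ coord (φ p) (s p')) p :=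
  smoothAlongAt_iff (mem_extChartAt_source (φ p))

theorem SmoothAlongAt.contMDiffAt (hs : SmoothAlongAt F φ s p) :
    ContMDiffAt 𝓘(ℝ, F) 𝓘(ℝ, E) ∞ φ p :=
  (smoothAlongAt_iff_coord_self.1 hs).1

theorem SmoothAlongAt.diffAlongAt (hs : SmoothAlongAt F φ s p) : DiffAlongAt F φ s p :=
  ContMDiffAt.mdifferentiableAt hs (by simp)

theorem SmoothAlongAt.eventually_diffAlongAt [IsManifold 𝓘(ℝ, F) ∞ M]
    (hs : SmoothAlongAt F φ s p) : ∀ᶠ p' in 𝓝 p, DiffAlongAt F φ s p' := by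
  have hC1 : ContMDiffAt 𝓘(ℝ, F) (𝓘(ℝ, E).prod 𝓘(ℝ, E)) 1
      (fun p ↦ (⟨φ p, s p⟩ : TotalSpace E (TangentSpace 𝓘(ℝ, E) : N → Type _))) p :=
    ContMDiffAt.of_le hs (by simp)
  exact ((contMDiffAt_iff_contMDiffAt_nhds (by simp)).1 hC1).mono
    fun _ h ↦ h.mdifferentiableAt (by norm_num)

theorem SmoothAlongAt.congr (hs : SmoothAlongAt F φ s p) (hst : ∀ᶠ p' in 𝓝 p, t p' = s p') :
    SmoothAlongAt F φ t p :=
  ContMDiffAt.congr_of_eventuallyEq hs (hst.mono fun p' hp' ↦ by simp only [hp'])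

theorem SmoothAlongAt.smul {a : M → ℝ} (ha : ContMDiffAt 𝓘(ℝ, F) 𝓘(ℝ, ℝ) ∞ a p)
    (hs : SmoothAlongAt F φ s p) : SmoothAlongAt F φ (fun p' ↦ a p' • s p') p := by
  rw [smoothAlongAt_iff_coord_self] at hs ⊢
  exact ⟨hs.1, (ha.smul hs.2).congr_of_eventuallyEq (eventuallyEq_coord_smul hs.1.continuousAt)⟩

end Rules

theorem smoothFieldAt_ofCoord {q₀ q : N} (hq : q ∈ (extChartAt 𝓘(ℝ, E) q₀).source) (a : E) :
    SmoothFieldAt (fun q ↦ ofCoord q₀ q a) q := by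
  refine (smoothAlongAt_iff (q₀ := q₀) hq).2
    ⟨contMDiffAt_id, (contMDiffAt_const (c := a)).congr_of_eventuallyEq ?_⟩
  filter_upwards [extChartAt_source_mem_nhds' (I := 𝓘(ℝ, E)) hq] with z hz
  exact coord_ofCoord hz a

theorem coord_model (y₀ : E) {y : E} (u : TangentSpace 𝓘(ℝ, E) y) : coord y₀ u = u :=
  congr(($(trivializationAt_model_space_apply (I := 𝓘(ℝ, E)) ⟨y, u⟩ y₀)).2)

section Differential

variable [IsManifold 𝓘(ℝ, F) ∞ M] {φ : M → N} {V : VField F M} {p : M}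

theorem smoothAlongAt_differential (hφ : ContMDiffAt 𝓘(ℝ, F) 𝓘(ℝ, E) ∞ φ p)
    (hV : SmoothFieldAt V p) : SmoothAlongAt F φ (fun p' ↦ differential E F φ p' (V p')) p :=
  ContMDiffAt.clm_apply_of_inCoordinates (b₁ := fun p : M ↦ p) (b₂ := φ) (v := V)
    (ϕ := fun p ↦ differential E F φ p) (hφ.mfderiv_const (by simp)) hV hφ

theorem contMDiffAt_mvfderiv {W : Type*} [NormedAddCommGroup W] [NormedSpace ℝ W] {f : M → W}
    (hf : ContMDiffAt 𝓘(ℝ, F) 𝓘(ℝ, W) ∞ f p) (hV : SmoothFieldAt V p) :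
    ContMDiffAt 𝓘(ℝ, F) 𝓘(ℝ, W) ∞ (fun p' ↦ mvfderiv 𝓘(ℝ, F) f p' (V p')) p :=
  (smoothAlongAt_iff_coord_self.1 (smoothAlongAt_differential hf hV)).2.congr_of_eventuallyEq
    (Filter.Eventually.of_forall fun _ ↦ (coord_model _ _).symm)

end Differential

end Smooth

/-! ## Riemannian metrics -/

section Riemannian

variable {E : Type*} [NormedAddCommGroup E] [NormedSpace ℝ E]
  {N : Type*} [TopologicalSpace N] [ChartedSpace E N] [IsManifold 𝓘(ℝ, E) ∞ N]
  {F : Type*} [NormedAddCommGroup F] [NormedSpace ℝ F]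
  {M : Type*} [TopologicalSpace M] [ChartedSpace F M]
  {g : FormField E N} {φ : M → N} {s t : ∀ p : M, TangentSpace 𝓘(ℝ, E) (φ p)} {p : M}

/-- `g` is a Riemannian metric: symmetric, positive definite, and with smooth components in the
preferred charts. -/
structure IsRiemannianMetric (g : FormField E N) : Prop where
  symm : ∀ (q : N) (v w : TangentSpace 𝓘(ℝ, E) q), g q v w = g q w v
  pos : ∀ (q : N) (v : TangentSpace 𝓘(ℝ, E) q), v ≠ 0 → 0 < g q v v
  contDiffOn_chartForm : ∀ q₀ : N,
    ContDiffOn ℝ ∞ (chartForm g q₀) (extChartAt 𝓘(ℝ, E) q₀).target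

theorem contDiffOn_chartForm_of_contMDiffAt [FiniteDimensional ℝ E]
    (hg : ∀ (X Y : VField E N) (q : N), SmoothFieldAt X q → SmoothFieldAt Y q →
      ContMDiffAt 𝓘(ℝ, E) 𝓘(ℝ, ℝ) ∞ (fun q' ↦ g q' (X q') (Y q')) q) (q₀ : N) :
    ContDiffOn ℝ ∞ (chartForm g q₀) (extChartAt 𝓘(ℝ, E) q₀).target := by
  refine contDiffOn_clm_apply.2 fun a ↦ contDiffOn_clm_apply.2 fun b y hy ↦ ?_
  have hq := (extChartAt 𝓘(ℝ, E) q₀).map_target hy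
  have hsymm : ContMDiffAt 𝓘(ℝ, E) 𝓘(ℝ, E) ∞ (extChartAt 𝓘(ℝ, E) q₀).symm y :=
    (contMDiffOn_extChartAt_symm q₀).contMDiffAt (extChartAt_target_mem_nhds' hy)
  exact (ContMDiffAt.comp y (hg _ _ _ (smoothFieldAt_ofCoord hq a) (smoothFieldAt_ofCoord hq b))
    hsymm).contDiffAt.contDiffWithinAt

namespace IsRiemannianMetric

variable (hg : IsRiemannianMetric g)

include hg

theorem isInvertible [FiniteDimensional ℝ E] (q : N) : (formAt g q).IsInvertible :=
  isInvertible_of_pos (hg.pos q)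

theorem contDiffAt_chartForm {q₀ : N} {y : E} (hy : y ∈ (extChartAt 𝓘(ℝ, E) q₀).target) :
    ContDiffAt ℝ ∞ (chartForm g q₀) y :=
  (hg.contDiffOn_chartForm q₀).contDiffAt (extChartAt_target_mem_nhds' hy)

theorem isRegularAt [FiniteDimensional ℝ E] (q : N) : IsRegularAt g q where
  symm := hg.symm
  invertible := hg.isInvertible q
  differentiableAt :=
    (hg.contDiffAt_chartForm (mem_extChartAt_target q)).differentiableAt (by simp)

theorem contMDiffAt_chartForm_comp (hφ : ContMDiffAt 𝓘(ℝ, F) 𝓘(ℝ, E) ∞ φ p) :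
    ContMDiffAt 𝓘(ℝ, F) 𝓘(ℝ, E →L[ℝ] E →L[ℝ] ℝ) ∞
      (fun p' ↦ chartForm g (φ p) (extChartAt 𝓘(ℝ, E) (φ p) (φ p'))) p :=
  ContMDiffAt.comp (g := chartForm g (φ p)) p
    (hg.contDiffAt_chartForm (mem_extChartAt_target (φ p))).contMDiffAt
    (ContMDiffAt.comp (g := extChartAt 𝓘(ℝ, E) (φ p)) p contMDiffAt_extChartAt hφ)

theorem contMDiffAt_apply (hs : SmoothAlongAt F φ s p) (ht : SmoothAlongAt F φ t p) :
    ContMDiffAt 𝓘(ℝ, F) 𝓘(ℝ, ℝ) ∞ (fun p' ↦ g (φ p') (s p') (t p')) p :=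
  (((hg.contMDiffAt_chartForm_comp hs.contMDiffAt).clm_apply
    (smoothAlongAt_iff_coord_self.1 hs).2).clm_apply
      (smoothAlongAt_iff_coord_self.1 ht).2).congr_of_eventuallyEq
        (metric_eventuallyEq_chartForm g hs.contMDiffAt.continuousAt)

theorem induced [IsManifold 𝓘(ℝ, F) ∞ M] [FiniteDimensional ℝ F]
    (hφ : IsSmoothImmersion E F φ) : IsRiemannianMetric (inducedMetric (F := F) g φ) where
  symm p _ _ := hg.symm (φ p) _ _
  pos p _ hv := hg.pos (φ p) _ fun h ↦ hv ((map_eq_zero_iff _ (hφ.2 p)).1 h)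
  contDiffOn_chartForm := contDiffOn_chartForm_of_contMDiffAt fun _ _ p hV hW ↦
    hg.contMDiffAt_apply (smoothAlongAt_differential (hφ.1 p) hV)
      (smoothAlongAt_differential (hφ.1 p) hW)

end IsRiemannianMetric

end Riemannian

/-! ## Smoothness of the covariant derivative -/

section FixedChart

variable {E : Type*} [NormedAddCommGroup E] [NormedSpace ℝ E]
  {N : Type*} [TopologicalSpace N] [ChartedSpace E N] [IsManifold 𝓘(ℝ, E) ∞ N]
  {E' : Type*} [NormedAddCommGroup E'] [NormedSpace ℝ E']
  {N' : Type*} [TopologicalSpace N'] [ChartedSpace E' N'] [IsManifold 𝓘(ℝ, E') ∞ N']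
  {F : Type*} [NormedAddCommGroup F] [NormedSpace ℝ F]
  {M : Type*} [TopologicalSpace M] [ChartedSpace F M]

theorem koszulCovector_congr {G G' : E → E →L[ℝ] E →L[ℝ] ℝ} {y : E} (h : G =ᶠ[𝓝 y] G') (u v : E) :
    koszulCovector G y u v = koszulCovector G' y u v := by
  have happly (a : E) : (fun z ↦ G z a) =ᶠ[𝓝 y] fun z ↦ G' z a :=
    h.fun_comp fun B : E →L[ℝ] E →L[ℝ] ℝ ↦ B a
  have happly₂ : (fun z ↦ G z u v) =ᶠ[𝓝 y] fun z ↦ G' z u v :=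
    h.fun_comp fun B : E →L[ℝ] E →L[ℝ] ℝ ↦ B u v
  simp only [koszulCovector, (happly _).fderiv_eq, happly₂.fderiv_eq]

theorem christoffel_congr {g g' : FormField E N} {q : N} (h : ∀ᶠ q' in 𝓝 q, g q' = g' q')
    (u v : TangentSpace 𝓘(ℝ, E) q) : christoffel g q u v = christoffel g' q u v := by
  have hsymm : Filter.Tendsto (extChartAt 𝓘(ℝ, E) q).symm (𝓝 (extChartAt 𝓘(ℝ, E) q q)) (𝓝 q) := by
    simpa only [ContinuousAt, extChartAt_to_inv] using continuousAt_extChartAt_symm (I := 𝓘(ℝ, E)) q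
  have hchart : chartForm g q =ᶠ[𝓝 (extChartAt 𝓘(ℝ, E) q q)] chartForm g' q :=
    (hsymm.eventually h).mono fun z hz ↦ by simp only [chartForm, hz]
  rw [christoffel, christoffel, h.self_of_nhds]
  exact congr((formAt g' q).inverse $(koszulCovector_congr hchart u v))

theorem contMDiffAt_koszulCovector [FiniteDimensional ℝ E] {G : E → E →L[ℝ] E →L[ℝ] ℝ}
    {y u v w : M → E} {p : M} (hG : ContDiffAt ℝ ∞ G (y p))
    (hy : ContMDiffAt 𝓘(ℝ, F) 𝓘(ℝ, E) ∞ y p) (hu : ContMDiffAt 𝓘(ℝ, F) 𝓘(ℝ, E) ∞ u p)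
    (hv : ContMDiffAt 𝓘(ℝ, F) 𝓘(ℝ, E) ∞ v p) (hw : ContMDiffAt 𝓘(ℝ, F) 𝓘(ℝ, E) ∞ w p) :
    ContMDiffAt 𝓘(ℝ, F) 𝓘(ℝ, ℝ) ∞
      (fun p' ↦ koszulCovector G (y p') (u p') (v p') (w p')) p := by
  have hdG : ContMDiffAt 𝓘(ℝ, F) 𝓘(ℝ, E →L[ℝ] E →L[ℝ] E →L[ℝ] ℝ) ∞
      (fun p' ↦ fderiv ℝ G (y p')) p :=
    ContMDiffAt.comp (g := fderiv ℝ G) p (hG.fderiv_right (m := ∞) (by simp)).contMDiffAt hy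
  refine (contMDiffAt_const (c := (2⁻¹ : ℝ)).mul
    (((((hdG.clm_apply hu).clm_apply hv).clm_apply hw).add
      (((hdG.clm_apply hv).clm_apply hu).clm_apply hw)).sub
      (((hdG.clm_apply hw).clm_apply hu).clm_apply hv))).congr_of_eventuallyEq ?_
  filter_upwards [hy.continuousAt.eventually
    ((hG.of_le (m := 1) (by simp)).eventually (by simp))] with p' hp'
  exact koszulCovector_apply (hp'.differentiableAt (by norm_num)) _ _ _

theorem metric_covAlong_of_isometry {g : FormField E N} {g' : FormField E' N'} {Φ : N → N'}
    {φ : M → N} {s : ∀ p : M, TangentSpace 𝓘(ℝ, E) (φ p)} {p : M}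
    (hΦ : ContMDiffAt 𝓘(ℝ, E) 𝓘(ℝ, E') 2 Φ (φ p)) (hg' : IsRegularAt g' (Φ (φ p)))
    (hi : (formAt g (φ p)).IsInvertible)
    (hisometry : ∀ᶠ q in 𝓝 (φ p), inducedMetric (F := E) g' Φ q = g q)
    (hs : DiffAlongAt F φ s p) (v : TangentSpace 𝓘(ℝ, F) p) (w : TangentSpace 𝓘(ℝ, E) (φ p)) :
    g (φ p) (covAlong g φ s p v) w =
      g' (Φ (φ p))
        (covAlong g' (fun p' ↦ Φ (φ p')) (fun p' ↦ differential E' E Φ (φ p') (s p')) p v)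
        (differential E' E Φ (φ p) w) := by
  have hcov : covAlong (inducedMetric g' Φ) φ s p v = covAlong g φ s p v := by
    rw [covAlong_eq, covAlong_eq, christoffel_congr hisometry]
  have hform : formAt (inducedMetric (F := E) g' Φ) (φ p) = formAt g (φ p) :=
    hisometry.self_of_nhds
  rw [covAlong_differential g' hΦ hs, map_add, add_apply,
    metric_gaussForm hg' (by rwa [hform]) hΦ, add_zero, hcov]
  exact congr($hform.symm (covAlong g φ s p v) w)

/-- A field of forms on the model space, as a field of forms on the tangent spaces. -/
def modelForm (G : E → E →L[ℝ] E →L[ℝ] ℝ) : FormField E E := G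

theorem chartForm_modelForm (G : E → E →L[ℝ] E →L[ℝ] ℝ) (y : E) :
    chartForm (modelForm G) y = G := by
  ext z a b
  have hz : z ∈ (extChartAt 𝓘(ℝ, E) y).source := by
    rw [extChartAt_model_space_eq_id]
    exact mem_univ z
  have hcoord (c : E) : coord (q := z) y c = c := coord_model y c
  have h := chartForm_coord hz (modelForm G) a b
  rw [extChartAt_model_space_eq_id] at h
  exact congr(chartForm (modelForm G) y z $((hcoord a).symm) $((hcoord b).symm)).trans h

theorem metric_covAlong_modelForm {G : E → E →L[ℝ] E →L[ℝ] ℝ} {c a : M → E} {p : M}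
    (hG : IsRegularAt (modelForm G) (c p)) (v : TangentSpace 𝓘(ℝ, F) p) (w : E) :
    G (c p) (covAlong (modelForm G) c a p v) w =
      G (c p) (mvfderiv 𝓘(ℝ, F) a p v) w
        + koszulCovector G (c p) (differential E F c p v) (a p) w := by
  have hderiv : derivCoord c a p v = mvfderiv 𝓘(ℝ, F) a p v :=
    congr(mvfderiv 𝓘(ℝ, F) $(funext fun p' ↦ coord_model (y := c p') (c p) (a p')) p v)
  have hΓ := metric_christoffel hG (differential E F c p v) (a p) w
  rw [chartForm_modelForm, extChartAt_model_space_eq_id] at hΓ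
  calc G (c p) (covAlong (modelForm G) c a p v) w
      = G (c p) (derivCoord c a p v) w
        + G (c p) (christoffel (modelForm G) (c p) (differential E F c p v) (a p)) w :=
        congr($(map_add (G (c p)) _ _) w)
    _ = _ := congr(G (c p) $hderiv w + $hΓ)

variable {g : FormField E N} {φ : M → N} {s t : ∀ p : M, TangentSpace 𝓘(ℝ, E) (φ p)} {p : M}
  {q₀ : N}

theorem inducedMetric_extChartAt (g : FormField E N) {q : N}
    (hq : q ∈ (extChartAt 𝓘(ℝ, E) q₀).source) :
    inducedMetric (modelForm (chartForm g q₀)) (extChartAt 𝓘(ℝ, E) q₀) q = g q := by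
  ext u w
  have h := chartForm_coord hq g u w
  rwa [coord_eq_mvfderiv hq, coord_eq_mvfderiv hq] at h

variable [FiniteDimensional ℝ E] (hg : IsRiemannianMetric g)

include hg

theorem IsRiemannianMetric.isRegularAt_modelForm {y : E}
    (hy : y ∈ (extChartAt 𝓘(ℝ, E) q₀).target) : IsRegularAt (modelForm (chartForm g q₀)) y where
  symm z u v := hg.symm ((extChartAt 𝓘(ℝ, E) q₀).symm z) (ofCoord q₀ _ u) (ofCoord q₀ _ v)
  invertible := by
    refine isInvertible_of_pos fun a ha ↦
      hg.pos ((extChartAt 𝓘(ℝ, E) q₀).symm y) (ofCoord q₀ _ a) fun h0 ↦ ha ?_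
    have hq := (extChartAt 𝓘(ℝ, E) q₀).map_target hy
    rw [← coord_ofCoord hq a, coord_eq_continuousLinearMapAt hq, h0, map_zero]
  differentiableAt := by
    rw [chartForm_modelForm, extChartAt_model_space_eq_id]
    exact (hg.contDiffAt_chartForm hy).differentiableAt (by simp)

theorem metric_covAlong_eq_koszulCovector (hp : φ p ∈ (extChartAt 𝓘(ℝ, E) q₀).source)
    (hs : DiffAlongAt F φ s p) (v : TangentSpace 𝓘(ℝ, F) p) (w : TangentSpace 𝓘(ℝ, E) (φ p)) :
    g (φ p) (covAlong g φ s p v) w =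
      chartForm g q₀ (extChartAt 𝓘(ℝ, E) q₀ (φ p))
        (mvfderiv 𝓘(ℝ, F) (fun p' ↦ coord q₀ (s p')) p v) (coord q₀ w)
      + koszulCovector (chartForm g q₀) (extChartAt 𝓘(ℝ, E) q₀ (φ p))
        (coord q₀ (differential E F φ p v)) (coord q₀ (s p)) (coord q₀ w) := by
  set c := extChartAt 𝓘(ℝ, E) q₀
  have hc : ContMDiffAt 𝓘(ℝ, E) 𝓘(ℝ, E) 2 c (φ p) :=
    (contMDiffAt_extChartAt' (n := ∞) (by rwa [← extChartAt_source 𝓘(ℝ, E)])).of_le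
      ENat.LEInfty.out
  have hG : IsRegularAt (modelForm (chartForm g q₀)) (c (φ p)) :=
    hg.isRegularAt_modelForm (c.map_source hp)
  have hsource : ∀ᶠ q in 𝓝 (φ p), q ∈ c.source := extChartAt_source_mem_nhds' hp
  let sCoord : M → E := fun p' ↦ coord q₀ (s p')
  have hcoord : ∀ᶠ p' in 𝓝 p, differential E E c (φ p') (s p') = sCoord p' :=
    (hs.continuousAt.eventually hsource).mono fun _ hp' ↦ (coord_eq_mvfderiv hp' _).symm
  have hchain : differential E F (fun p' ↦ c (φ p')) p v = coord q₀ (differential E F φ p v) := by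
    rw [coord_eq_mvfderiv hp]
    exact mfderiv_comp_apply (g := c) p (hc.mdifferentiableAt (by norm_num))
      (diffAlongAt_iff.1 hs).1 v
  have hisometry := metric_covAlong_of_isometry hc hG (hg.isInvertible _)
    (hsource.mono fun _ hq ↦ inducedMetric_extChartAt g hq) hs v w
  have hcov : covAlong (modelForm (chartForm g q₀)) (fun p' ↦ c (φ p'))
      (fun p' ↦ differential E E c (φ p') (s p')) p v =
      covAlong (modelForm (chartForm g q₀)) (fun p' ↦ c (φ p')) sCoord p v :=
    covAlong_congr hcoord v
  have hmodel := metric_covAlong_modelForm (c := fun p' ↦ c (φ p')) (a := sCoord) hG v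
    (differential E E c (φ p) w)
  rw [hchain] at hmodel
  rw [hcov] at hisometry
  rw [coord_eq_mvfderiv hp w]
  exact hisometry.trans hmodel

theorem contMDiffAt_metric_covAlong [IsManifold 𝓘(ℝ, F) ∞ M] {V : VField F M}
    (hV : SmoothFieldAt V p) (hs : SmoothAlongAt F φ s p) (ht : SmoothAlongAt F φ t p) :
    ContMDiffAt 𝓘(ℝ, F) 𝓘(ℝ, ℝ) ∞ (fun p' ↦ g (φ p') (covAlong g φ s p' (V p')) (t p')) p := by
  have hφ := hs.contMDiffAt
  have hs_coord := (smoothAlongAt_iff_coord_self.1 hs).2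
  have ht_coord := (smoothAlongAt_iff_coord_self.1 ht).2
  have hV_coord := (smoothAlongAt_iff_coord_self.1 (smoothAlongAt_differential hφ hV)).2
  refine ((((hg.contMDiffAt_chartForm_comp hφ).clm_apply
    (contMDiffAt_mvfderiv hs_coord hV)).clm_apply ht_coord).add
      (contMDiffAt_koszulCovector (hg.contDiffAt_chartForm (mem_extChartAt_target (φ p)))
        (ContMDiffAt.comp (g := extChartAt 𝓘(ℝ, E) (φ p)) p contMDiffAt_extChartAt hφ)
        hV_coord hs_coord ht_coord)).congr_of_eventuallyEq ?_
  filter_upwards [hs.eventually_diffAlongAt,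
    eventually_mem_extChartAt_source (E := E) hφ.continuousAt] with p' hs' hp'
  exact metric_covAlong_eq_koszulCovector hg hp' hs' _ _

end FixedChart

/-! ## Parallel fields of endomorphisms -/

section Parallel

variable {E : Type*} [NormedAddCommGroup E] [NormedSpace ℝ E]
  {N : Type*} [TopologicalSpace N] [ChartedSpace E N] [IsManifold 𝓘(ℝ, E) ∞ N]

section Frame

variable [FiniteDimensional ℝ E] [T2Space N]

theorem exists_smoothField_eventuallyEq_ofCoord (q : N) (a : E) :
    ∃ X : VField E N, SmoothField X ∧ ∀ᶠ q' in 𝓝 q, X q' = ofCoord q q' a := by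
  obtain ⟨f⟩ : Nonempty (SmoothBumpFunction 𝓘(ℝ, E) q) := inferInstance
  refine ⟨fun q' ↦ f q' • ofCoord q q' a, ?_, ?_⟩
  · refine ContMDiffOn.smul_section_of_tsupport (u := (chartAt E q).source)
      (s := fun q' ↦ ofCoord q q' a) (ψ := f) f.contMDiff.contMDiffOn (chartAt E q).open_source
      f.tsupport_subset_chartAt_source fun q' hq' ↦ ContMDiffAt.contMDiffWithinAt ?_
    exact smoothFieldAt_ofCoord (by rwa [extChartAt_source]) a
  · filter_upwards [f.eventuallyEq_one] with q' hq'
    rw [hq', Pi.one_apply, one_smul]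

theorem exists_smoothField_eventually_eq_sum {ι : Type*} [Fintype ι] (b : Module.Basis ι ℝ E)
    (q : N) :
    ∃ X : ι → VField E N, (∀ i, SmoothField (X i)) ∧
      ∀ᶠ q' in 𝓝 q, ∀ u : TangentSpace 𝓘(ℝ, E) q', u = ∑ i, b.coord i (coord q u) • X i q' := by
  choose X hX hXq using fun i ↦ exists_smoothField_eventuallyEq_ofCoord q (b i)
  refine ⟨X, hX, ?_⟩
  filter_upwards [Filter.eventually_all.2 hXq, extChartAt_source_mem_nhds (I := 𝓘(ℝ, E)) q]
    with q' hXq' hq' u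
  calc u = ofCoord q q' (∑ i, b.coord i (coord q u) • b i) := by
        simp only [Module.Basis.coord_apply, b.sum_repr, ofCoord_coord hq']
    _ = ∑ i, b.coord i (coord q u) • X i q' := by
        simp only [hXq', ofCoord, map_sum, map_smul]

end Frame

variable {F : Type*} [NormedAddCommGroup F] [NormedSpace ℝ F]
  {M : Type*} [TopologicalSpace M] [ChartedSpace F M]
  {g : FormField E N} {φ : M → N} {p : M}

theorem DiffAlongAt.comp {X : VField E N} (hX : DiffAlongAt E (fun q : N ↦ q) X (φ p))
    (hφ : MDifferentiableAt 𝓘(ℝ, F) 𝓘(ℝ, E) φ p) : DiffAlongAt F φ (fun p' ↦ X (φ p')) p :=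
  MDifferentiableAt.comp (f := φ) p hX hφ

theorem covAlong_comp {X : VField E N} (hX : DiffAlongAt E (fun q : N ↦ q) X (φ p))
    (hφ : MDifferentiableAt 𝓘(ℝ, F) 𝓘(ℝ, E) φ p) (v : TangentSpace 𝓘(ℝ, F) p) :
    covAlong g φ (fun p' ↦ X (φ p')) p v = leviCivita g X (φ p) (differential E F φ p v) := by
  have hderiv : derivCoord φ (fun p' ↦ X (φ p')) p v =
      derivCoord (fun q : N ↦ q) X (φ p) (differential E F φ p v) :=
    mfderiv_comp_apply (g := fun q ↦ coord (φ p) (X q)) p (diffAlongAt_iff.1 hX).2 hφ v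
  have hid : differential E E (fun q : N ↦ q) (φ p) (differential E F φ p v) =
      differential E F φ p v :=
    congr($(mfderiv_id (I := 𝓘(ℝ, E)) (x := φ p)) (differential E F φ p v))
  rw [leviCivita, covAlong_eq, covAlong_eq, hderiv, hid]

theorem diffAlongAt_zero (hφ : MDifferentiableAt 𝓘(ℝ, F) 𝓘(ℝ, E) φ p) :
    DiffAlongAt F φ (fun p' ↦ (0 : TangentSpace 𝓘(ℝ, E) (φ p'))) p := by
  refine diffAlongAt_iff.2
    ⟨hφ, (mdifferentiableAt_const (c := (0 : E))).congr_of_eventuallyEq ?_⟩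
  filter_upwards [eventually_mem_extChartAt_source (E := E) hφ.continuousAt] with p' hp'
  rw [coord_eq_continuousLinearMapAt hp', map_zero]

theorem covAlong_zero (hg : IsRegularAt g (φ p)) (hφ : MDifferentiableAt 𝓘(ℝ, F) 𝓘(ℝ, E) φ p)
    (v : TangentSpace 𝓘(ℝ, F) p) : covAlong g φ (fun _ ↦ 0) p v = 0 := by
  have hsmul := covAlong_smul hg (mdifferentiableAt_const (c := (0 : ℝ)))
    (diffAlongAt_zero hφ) v
  simpa only [smul_zero, zero_smul, add_zero] using hsmul

section Sum

variable {ι : Type*} (S : Finset ι) {a : ι → M → ℝ} {t : ι → ∀ p : M, TangentSpace 𝓘(ℝ, E) (φ p)}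

theorem DiffAlongAt.sum_smul (hφ : MDifferentiableAt 𝓘(ℝ, F) 𝓘(ℝ, E) φ p)
    (ha : ∀ i, MDifferentiableAt 𝓘(ℝ, F) 𝓘(ℝ, ℝ) (a i) p) (ht : ∀ i, DiffAlongAt F φ (t i) p) :
    DiffAlongAt F φ (fun p' ↦ ∑ i ∈ S, a i p' • t i p') p := by
  classical
  induction S using Finset.induction_on with
  | empty => exact diffAlongAt_zero hφ
  | insert i S hi ih =>
    simp only [Finset.sum_insert hi]
    exact ((ht i).smul (ha i)).add ih

theorem covAlong_sum_smul (hg : IsRegularAt g (φ p)) (hφ : MDifferentiableAt 𝓘(ℝ, F) 𝓘(ℝ, E) φ p)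
    (ha : ∀ i, MDifferentiableAt 𝓘(ℝ, F) 𝓘(ℝ, ℝ) (a i) p) (ht : ∀ i, DiffAlongAt F φ (t i) p)
    (v : TangentSpace 𝓘(ℝ, F) p) :
    covAlong g φ (fun p' ↦ ∑ i ∈ S, a i p' • t i p') p v =
      ∑ i ∈ S, (a i p • covAlong g φ (t i) p v + mvfderiv 𝓘(ℝ, F) (a i) p v • t i p) := by
  classical
  induction S using Finset.induction_on with
  | empty => exact covAlong_zero hg hφ v
  | insert i S hi ih =>
    simp only [Finset.sum_insert hi]
    rw [covAlong_add hg ((ht i).smul (ha i)) (.sum_smul S hφ ha ht), ih,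
      covAlong_smul hg (ha i) (ht i)]

end Sum

theorem SmoothField.diffAlongAt {X : VField E N} (hX : SmoothField X) (q : N) :
    DiffAlongAt E (fun q : N ↦ q) X q :=
  (hX q).mdifferentiableAt (by simp)

theorem covAlong_endomorphism [FiniteDimensional ℝ E] [T2Space N]
    {J : ∀ q : N, TangentSpace 𝓘(ℝ, E) q →L[ℝ] TangentSpace 𝓘(ℝ, E) q}
    (hJ : ∀ X : VField E N, SmoothField X → SmoothField (fun q ↦ J q (X q)))
    (hparallel : ∀ X : VField E N, SmoothField X → ∀ (q : N) (v : TangentSpace 𝓘(ℝ, E) q),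
      leviCivita g (fun q' ↦ J q' (X q')) q v = J q (leviCivita g X q v))
    {s : ∀ p : M, TangentSpace 𝓘(ℝ, E) (φ p)} (hg : IsRegularAt g (φ p))
    (hs : DiffAlongAt F φ s p) (v : TangentSpace 𝓘(ℝ, F) p) :
    covAlong g φ (fun p' ↦ J (φ p') (s p')) p v = J (φ p) (covAlong g φ s p v) := by
  obtain ⟨hφ, hs_coord⟩ := diffAlongAt_iff.1 hs
  let b := Module.finBasis ℝ E
  obtain ⟨X, hX, hsum⟩ := exists_smoothField_eventually_eq_sum b (φ p)
  let a (i) (p' : M) : ℝ := b.coord i (coord (φ p) (s p'))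
  have ha (i) : MDifferentiableAt 𝓘(ℝ, F) 𝓘(ℝ, ℝ) (a i) p :=
    (b.coord i).toContinuousLinearMap.differentiableAt.comp_mdifferentiableAt hs_coord
  have hs_sum : ∀ᶠ p' in 𝓝 p, s p' = ∑ i, a i p' • X i (φ p') :=
    (hφ.continuousAt.eventually hsum).mono fun p' hp' ↦ hp' (s p')
  have hJs_sum : ∀ᶠ p' in 𝓝 p, J (φ p') (s p') = ∑ i, a i p' • J (φ p') (X i (φ p')) :=
    hs_sum.mono fun p' hp' ↦ by
      simpa only [map_sum, map_smul] using congr(J (φ p') $hp')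
  have hX_diff (i) := (hX i).diffAlongAt (φ p)
  have hJX_diff (i) := (hJ _ (hX i)).diffAlongAt (φ p)
  rw [covAlong_congr hJs_sum, covAlong_congr hs_sum,
    covAlong_sum_smul _ hg hφ ha fun i ↦ (hJX_diff i).comp hφ,
    covAlong_sum_smul _ hg hφ ha fun i ↦ (hX_diff i).comp hφ]
  simp only [map_sum, map_add, map_smul, covAlong_comp (hJX_diff _) hφ,
    covAlong_comp (hX_diff _) hφ, hparallel _ (hX _)]

end Parallel

/-! ## Derivatives along vector fields -/

section VectorField

open VectorField

variable {F : Type*} [NormedAddCommGroup F] [NormedSpace ℝ F]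
  {M : Type*} [TopologicalSpace M] [ChartedSpace F M] [IsManifold 𝓘(ℝ, F) ∞ M]

section Bracket

variable [CompleteSpace F] {U V W : VField F M} {a : M → ℝ} {p : M}

theorem minSmoothness_le_infty {n : WithTop ℕ∞} (hn : n ≤ ∞) : minSmoothness ℝ n ≤ ∞ := by
  rwa [minSmoothness_of_isRCLikeNormedField]

theorem SmoothFieldAt.mlieBracket (hU : SmoothFieldAt U p) (hV : SmoothFieldAt V p) :
    SmoothFieldAt (mlieBracket 𝓘(ℝ, F) U V) p :=
  have : IsManifold 𝓘(ℝ, F) (((⊤ : ℕ∞) : WithTop ℕ∞) + 1) M :=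
    inferInstanceAs (IsManifold 𝓘(ℝ, F) ∞ M)
  have : IsManifold 𝓘(ℝ, F) (minSmoothness ℝ 2) M :=
    IsManifold.of_le (minSmoothness_le_infty ENat.LEInfty.out)
  ContMDiffAt.mlieBracket_vectorField (m := ⊤) (n := ⊤) hU hV (by simp)

theorem mlieBracket_mlieBracket_smul (hV : SmoothFieldAt V p) (hW : SmoothFieldAt W p)
    (ha : ContMDiffAt 𝓘(ℝ, F) 𝓘(ℝ, ℝ) ∞ a p) :
    mlieBracket 𝓘(ℝ, F) U (mlieBracket 𝓘(ℝ, F) V (a • W)) p =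
      (mvfderiv 𝓘(ℝ, F) (fun q ↦ mvfderiv 𝓘(ℝ, F) a q (V q)) p (U p) • W p
        + mvfderiv 𝓘(ℝ, F) a p (V p) • mlieBracket 𝓘(ℝ, F) U W p)
      + (mvfderiv 𝓘(ℝ, F) a p (U p) • mlieBracket 𝓘(ℝ, F) V W p
        + a p • mlieBracket 𝓘(ℝ, F) U (mlieBracket 𝓘(ℝ, F) V W) p) := by
  have hVa : ContMDiffAt 𝓘(ℝ, F) 𝓘(ℝ, ℝ) ∞ (fun q ↦ mvfderiv 𝓘(ℝ, F) a q (V q)) p :=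
    contMDiffAt_mvfderiv ha hV
  have hVW := hV.mlieBracket hW
  have hVaW : SmoothFieldAt ((fun q ↦ mvfderiv 𝓘(ℝ, F) a q (V q)) • W) p := .smul hVa hW
  have haVW : SmoothFieldAt (a • mlieBracket 𝓘(ℝ, F) V W) p := .smul ha hVW
  have hinner : mlieBracket 𝓘(ℝ, F) V (a • W) =ᶠ[𝓝 p]
      (fun q ↦ mvfderiv 𝓘(ℝ, F) a q (V q)) • W + a • mlieBracket 𝓘(ℝ, F) V W := by
    filter_upwards [eventually_mdifferentiableAt (ha.of_le ENat.LEInfty.out),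
      hW.eventually_diffAlongAt] with q haq hWq
    exact mlieBracket_smul_right haq hWq
  rw [Filter.EventuallyEq.mlieBracket_vectorField_eq (Filter.EventuallyEq.refl _ U) hinner,
    mlieBracket_add_right hVaW.diffAlongAt haVW.diffAlongAt,
    mlieBracket_smul_right (hVa.mdifferentiableAt (by simp)) hW.diffAlongAt,
    mlieBracket_smul_right (ha.mdifferentiableAt (by simp)) hVW.diffAlongAt]

-- Compare the coefficients of `W` in the Jacobi identity for `U`, `V` and `a • W`.
theorem mvfderiv_mlieBracket (hU : SmoothFieldAt U p) (hV : SmoothFieldAt V p)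
    (ha : ContMDiffAt 𝓘(ℝ, F) 𝓘(ℝ, ℝ) ∞ a p) :
    mvfderiv 𝓘(ℝ, F) a p (mlieBracket 𝓘(ℝ, F) U V p) =
      mvfderiv 𝓘(ℝ, F) (fun q ↦ mvfderiv 𝓘(ℝ, F) a q (V q)) p (U p)
        - mvfderiv 𝓘(ℝ, F) (fun q ↦ mvfderiv 𝓘(ℝ, F) a q (U q)) p (V p) := by
  have : IsManifold 𝓘(ℝ, F) (minSmoothness ℝ 3) M :=
    IsManifold.of_le (minSmoothness_le_infty ENat.LEInfty.out)
  obtain hF | hF := subsingleton_or_nontrivial F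
  · have hzero (w : TangentSpace 𝓘(ℝ, F) p) : w = 0 := hF.elim _ _
    rw [hzero (mlieBracket 𝓘(ℝ, F) U V p), hzero (U p), hzero (V p)]
    simp only [map_zero, sub_zero]
  obtain ⟨x, hx⟩ := exists_ne (0 : F)
  let W : VField F M := fun q ↦ ofCoord p q x
  have hW : SmoothFieldAt W p := smoothFieldAt_ofCoord (mem_extChartAt_source p) x
  have hWp : W p = x := by
    rw [← coord_self (W p)]
    exact coord_ofCoord (mem_extChartAt_source p) x
  have jacobi {T : VField F M} (hT : SmoothFieldAt T p) :
      mlieBracket 𝓘(ℝ, F) U (mlieBracket 𝓘(ℝ, F) V T) p =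
        mlieBracket 𝓘(ℝ, F) (mlieBracket 𝓘(ℝ, F) U V) T p
          + mlieBracket 𝓘(ℝ, F) V (mlieBracket 𝓘(ℝ, F) U T) p :=
    leibniz_identity_mlieBracket_apply
      (ContMDiffAt.of_le hU (minSmoothness_le_infty ENat.LEInfty.out))
      (ContMDiffAt.of_le hV (minSmoothness_le_infty ENat.LEInfty.out))
      (ContMDiffAt.of_le hT (minSmoothness_le_infty ENat.LEInfty.out))
  have hjacobi := jacobi (T := a • W) (SmoothAlongAt.smul ha hW)
  rw [mlieBracket_mlieBracket_smul hV hW ha, mlieBracket_mlieBracket_smul hU hW ha,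
    jacobi hW, mlieBracket_smul_right (ha.mdifferentiableAt (by simp)) hW.diffAlongAt] at hjacobi
  refine sub_eq_zero.1 ((smul_eq_zero.1 ?_).resolve_right (hWp.trans_ne hx))
  rw [smul_add, ← sub_eq_zero] at hjacobi
  rw [sub_smul, sub_smul, ← neg_eq_zero, ← hjacobi]
  abel

end Bracket

theorem isLocallyConstant_of_mvfderiv_eq_zero {f : M → ℝ}
    (hf : ∀ p, MDifferentiableAt 𝓘(ℝ, F) 𝓘(ℝ, ℝ) f p)
    (hderiv : ∀ p v, mvfderiv 𝓘(ℝ, F) f p v = 0) : IsLocallyConstant f := by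
  refine (IsLocallyConstant.iff_eventually_eq f).2 fun p ↦ ?_
  set ψ := extChartAt 𝓘(ℝ, F) p
  obtain ⟨r, hr, hball⟩ := Metric.mem_nhds_iff.1 (extChartAt_target_mem_nhds (I := 𝓘(ℝ, F)) p)
  have hderiv_chart (y) (hy : y ∈ Metric.ball (ψ p) r) :
      HasFDerivAt (fun y ↦ f (ψ.symm y)) (0 : F →L[ℝ] ℝ) y := by
    have hsymm : ContMDiffAt 𝓘(ℝ, F) 𝓘(ℝ, F) ∞ ψ.symm y :=
      (contMDiffOn_extChartAt_symm p).contMDiffAt (extChartAt_target_mem_nhds' (hball hy))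
    have hcomp := HasMFDerivAt.comp (g := f) (f := ψ.symm) y (hf _).hasMFDerivAt
      (hsymm.mdifferentiableAt (by simp)).hasMFDerivAt
    have hzero : (mfderiv 𝓘(ℝ, F) 𝓘(ℝ, ℝ) f (ψ.symm y)).comp
        (mfderiv 𝓘(ℝ, F) 𝓘(ℝ, F) ψ.symm y) = 0 := by
      ext v
      exact hderiv _ _
    exact (hzero ▸ hcomp).hasFDerivAt
  have hconst (y) (hy : y ∈ Metric.ball (ψ p) r) : f (ψ.symm y) = f (ψ.symm (ψ p)) :=
    Metric.isOpen_ball.is_const_of_fderiv_eq_zero (𝕜 := ℝ) (f := fun y ↦ f (ψ.symm y))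
      (convex_ball (ψ p) r).isPreconnected
      (fun z hz ↦ (hderiv_chart z hz).differentiableAt.differentiableWithinAt)
      (fun z hz ↦ (hderiv_chart z hz).fderiv) hy (Metric.mem_ball_self hr)
  filter_upwards [extChartAt_source_mem_nhds (I := 𝓘(ℝ, F)) p,
    (continuousAt_extChartAt (I := 𝓘(ℝ, F)) p).preimage_mem_nhds (Metric.ball_mem_nhds _ hr)]
    with q hq hball_q
  rw [← ψ.left_inv hq, hconst _ hball_q, ψ.left_inv (mem_extChartAt_source p)]

end VectorField

/-! ## Orthonormal frames -/

section OrthonormalBasis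

variable {E : Type*} [NormedAddCommGroup E] [NormedSpace ℝ E]
  {ι : Type*} {B : E →L[ℝ] E →L[ℝ] ℝ} {e : ι → E}

theorem linearIndependent_of_orthonormal (he : ∀ i, B (e i) (e i) = 1)
    (horth : Pairwise fun i j ↦ B (e i) (e j) = 0) : LinearIndependent ℝ e := by
  refine linearIndependent_iff'.2 fun S c hsum j hj ↦ ?_
  have happly := congr(B $hsum (e j))
  simp only [map_sum, map_smul, sum_apply, smul_apply, smul_eq_mul, map_zero,
    zero_apply] at happly
  rwa [Finset.sum_eq_single_of_mem j hj fun i _ hij ↦ by rw [horth hij, mul_zero], he,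
    mul_one] at happly

variable [Fintype ι]

theorem exists_ne_sum_smul (B : E →L[ℝ] E →L[ℝ] ℝ) (e : ι → E)
    (hcard : Fintype.card ι < Module.finrank ℝ E) : ∃ x : E, x ≠ ∑ i, B x (e i) • e i := by
  by_contra! hsum
  refine (finrank_range_le_card (R := ℝ) e).not_gt ?_
  have hspan : Submodule.span ℝ (range e) = ⊤ := (Submodule.eq_top_iff' ..).2 fun x ↦ by
    rw [hsum x]
    exact Submodule.sum_mem _ fun i _ ↦ Submodule.smul_mem _ _ (Submodule.subset_span ⟨i, rfl⟩)
  rwa [Set.finrank, hspan, finrank_top]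

variable [FiniteDimensional ℝ E]

theorem eq_sum_of_orthonormal (he : ∀ i, B (e i) (e i) = 1)
    (horth : Pairwise fun i j ↦ B (e i) (e j) = 0) (hcard : Fintype.card ι = Module.finrank ℝ E)
    (w : E) : w = ∑ i, B w (e i) • e i := by
  have hspan := (linearIndependent_of_orthonormal he horth).span_eq_top_of_card_eq_finrank' hcard
  obtain ⟨c, rfl⟩ := (Submodule.mem_span_range_iff_exists_fun ℝ).1
    (hspan ▸ Submodule.mem_top : w ∈ Submodule.span ℝ (range e))
  refine Finset.sum_congr rfl fun j _ ↦ ?_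
  simp only [map_sum, map_smul, sum_apply, smul_apply, smul_eq_mul]
  rw [Fintype.sum_eq_single j fun i hij ↦ by rw [horth hij, mul_zero], he, mul_one]

theorem sum_apply_inverse_coord {V κ : Type*} [AddCommGroup V] [Module ℝ V] [Fintype κ]
    (he : ∀ i, B (e i) (e i) = 1) (horth : Pairwise fun i j ↦ B (e i) (e j) = 0)
    (hcard : Fintype.card ι = Module.finrank ℝ E) (hB : B.IsInvertible)
    (b : Module.Basis κ ℝ E) (S : E →ₗ[ℝ] E →ₗ[ℝ] V) :
    ∑ k, S (b k) (B.inverse (b.coord k).toContinuousLinearMap) = ∑ i, S (e i) (e i) := by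
  have hinverse (α : E →L[ℝ] ℝ) : B.inverse α = ∑ i, α (e i) • e i := by
    conv_lhs => rw [eq_sum_of_orthonormal he horth hcard (B.inverse α), hB.self_apply_inverse]
  calc ∑ k, S (b k) (B.inverse (b.coord k).toContinuousLinearMap)
      = ∑ k, ∑ i, S (b.repr (e i) k • b k) (e i) := by
        simp only [hinverse, map_sum, map_smul, LinearMap.smul_apply]
        rfl
    _ = ∑ i, S (∑ k, b.repr (e i) k • b k) (e i) := by
        rw [Finset.sum_comm]
        simp only [map_sum, LinearMap.sum_apply]
    _ = ∑ i, S (e i) (e i) := by simp only [b.sum_repr]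

end OrthonormalBasis

section Frame

variable {F : Type*} [NormedAddCommGroup F] [NormedSpace ℝ F]
  {M : Type*} [TopologicalSpace M] [ChartedSpace F M] [IsManifold 𝓘(ℝ, F) ∞ M]
  {γ : FormField F M} {ι : Type*} {e : ι → VField F M} {p : M}

/-- The vector fields `e i` are smooth at `p` and, near `p`, orthonormal for `γ`. -/
structure IsOrthonormalNear (γ : FormField F M) (p : M) (e : ι → VField F M) : Prop where
  smooth : ∀ i, SmoothFieldAt (e i) p
  unit : ∀ᶠ q in 𝓝 p, ∀ i, γ q (e i q) (e i q) = 1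
  orthogonal : ∀ᶠ q in 𝓝 p, Pairwise fun i j ↦ γ q (e i q) (e j q) = 0

theorem IsOrthonormalNear.eventually_eq_sum [Fintype ι] [FiniteDimensional ℝ F]
    (he : IsOrthonormalNear γ p e) (hcard : Fintype.card ι = Module.finrank ℝ F) :
    ∀ᶠ q in 𝓝 p, ∀ w : TangentSpace 𝓘(ℝ, F) q, w = ∑ i, γ q w (e i q) • e i q := by
  filter_upwards [he.unit, he.orthogonal] with q hunit horth
  exact eq_sum_of_orthonormal (B := formAt γ q) hunit horth hcard

section GramSchmidt

variable (hγ : IsRiemannianMetric γ)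

include hγ

theorem IsRiemannianMetric.exists_eventually_eq_smul_unit {V : VField F M}
    (hV : SmoothFieldAt V p) (hVp : V p ≠ 0) :
    ∃ a : M → ℝ, SmoothFieldAt (a • V) p ∧
      ∀ᶠ q in 𝓝 p, γ q ((a • V) q) ((a • V) q) = 1 := by
  have hnorm : ContMDiffAt 𝓘(ℝ, F) 𝓘(ℝ, ℝ) ∞ (fun q ↦ γ q (V q) (V q)) p :=
    hγ.contMDiffAt_apply hV hV
  have hpos : 0 < γ p (V p) (V p) := hγ.pos p _ hVp
  refine ⟨fun q ↦ (√(γ q (V q) (V q)))⁻¹, .smul ?_ hV, ?_⟩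
  · exact ContMDiffAt.comp p (g := fun t ↦ (√t)⁻¹) (f := fun q ↦ γ q (V q) (V q))
      ((Real.contDiffAt_sqrt hpos.ne').inv (Real.sqrt_pos.2 hpos).ne').contMDiffAt hnorm
  · filter_upwards [hnorm.continuousAt.eventually (lt_mem_nhds hpos)] with q hq
    simp only [Pi.smul_apply', map_smul, smul_apply, smul_eq_mul]
    rw [← mul_assoc, ← mul_inv, Real.mul_self_sqrt hq.le, inv_mul_cancel₀ hq.ne']

theorem IsOrthonormalNear.snoc {k : ℕ} {e : Fin k → VField F M} {V : VField F M}
    (he : IsOrthonormalNear γ p e) (hV : SmoothFieldAt V p)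
    (hunit : ∀ᶠ q in 𝓝 p, γ q (V q) (V q) = 1)
    (horth : ∀ᶠ q in 𝓝 p, ∀ i, γ q (V q) (e i q) = 0) :
    IsOrthonormalNear γ p (Fin.snoc e V : Fin (k + 1) → VField F M) := by
  refine ⟨fun i ↦ ?_, ?_, ?_⟩
  · cases i using Fin.lastCases with
    | last => simpa only [Fin.snoc_last] using hV
    | cast i => simpa only [Fin.snoc_castSucc] using he.smooth i
  · filter_upwards [he.unit, hunit] with q he_unit hV_unit i
    cases i using Fin.lastCases with
    | last => simpa only [Fin.snoc_last] using hV_unit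
    | cast i => simpa only [Fin.snoc_castSucc] using he_unit i
  · filter_upwards [he.orthogonal, horth] with q he_orth hV_orth i j hij
    cases i using Fin.lastCases with
    | last =>
      cases j using Fin.lastCases with
      | last => exact absurd rfl hij
      | cast j => simpa only [Fin.snoc_last, Fin.snoc_castSucc] using hV_orth j
    | cast i =>
      cases j using Fin.lastCases with
      | last => simpa only [Fin.snoc_last, Fin.snoc_castSucc, hγ.symm q (e i q)] using hV_orth i
      | cast j =>
        simpa only [Fin.snoc_castSucc] using he_orth fun h ↦ hij (congrArg Fin.castSucc h)

theorem IsOrthonormalNear.exists_snoc {k : ℕ} {e : Fin k → VField F M}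
    (he : IsOrthonormalNear γ p e) (hk : k < Module.finrank ℝ F) :
    ∃ V : VField F M, IsOrthonormalNear γ p (Fin.snoc e V : Fin (k + 1) → VField F M) := by
  obtain ⟨x, hx⟩ := exists_ne_sum_smul (formAt γ p) (fun i ↦ e i p) (by rwa [Fintype.card_fin])
  let X : VField F M := fun q ↦ ofCoord p q x
  have hX : SmoothFieldAt X p := smoothFieldAt_ofCoord (mem_extChartAt_source p) x
  have hXp : X p = x := ofCoord_self p x
  let W : VField F M := X - fun q ↦ ∑ i, γ q (X q) (e i q) • e i q
  have hW : SmoothFieldAt W p := ContMDiffAt.sub_section hX <| ContMDiffAt.sum_section fun i _ ↦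
    SmoothAlongAt.smul (hγ.contMDiffAt_apply hX (he.smooth i)) (he.smooth i)
  have hWp : W p ≠ 0 := fun h ↦ hx <| by
    rw [← hXp]
    exact sub_eq_zero.1 h
  have hW_orth : ∀ᶠ q in 𝓝 p, ∀ j, γ q (W q) (e j q) = 0 := by
    filter_upwards [he.unit, he.orthogonal] with q hunit horth j
    simp only [W, Pi.sub_apply, map_sub, map_sum, map_smul, sub_apply, sum_apply, smul_apply,
      smul_eq_mul]
    rw [Fintype.sum_eq_single j fun i hij ↦ by rw [horth hij, mul_zero], hunit, mul_one, sub_self]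
  obtain ⟨a, ha_smooth, ha_unit⟩ := hγ.exists_eventually_eq_smul_unit hW hWp
  refine ⟨a • W, he.snoc hγ ha_smooth ha_unit ?_⟩
  filter_upwards [hW_orth] with q hWq j
  rw [Pi.smul_apply', map_smul, smul_apply, hWq, smul_zero]

theorem IsOrthonormalNear.exists_extension {k n : ℕ} (hkn : k ≤ n) (hn : n ≤ Module.finrank ℝ F)
    {e : Fin k → VField F M} (he : IsOrthonormalNear γ p e) :
    ∃ e' : Fin n → VField F M, IsOrthonormalNear γ p e' ∧ ∀ i, e' (Fin.castLE hkn i) = e i := by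
  induction n, hkn using Nat.le_induction with
  | base => exact ⟨e, he, fun _ ↦ rfl⟩
  | succ n hkn ih =>
    obtain ⟨e', he', he'e⟩ := ih (by omega)
    obtain ⟨V, hV⟩ := he'.exists_snoc hγ (by omega)
    refine ⟨Fin.snoc e' V, hV, fun i ↦ ?_⟩
    rw [← he'e i]
    exact Fin.snoc_castSucc (α := fun _ ↦ VField F M) V e' (Fin.castLE hkn i)

theorem IsRiemannianMetric.exists_isOrthonormalNear (p : M) :
    ∃ e : Fin (Module.finrank ℝ F) → VField F M, IsOrthonormalNear γ p e := by
  have hempty : IsOrthonormalNear γ p (Fin.elim0 : Fin 0 → VField F M) :=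
    ⟨fun i ↦ i.elim0, .of_forall fun _ i ↦ i.elim0, .of_forall fun _ i ↦ i.elim0⟩
  obtain ⟨e, he, -⟩ := hempty.exists_extension hγ (Nat.zero_le _) le_rfl
  exact ⟨e, he⟩

end GramSchmidt

end Frame

/-! ## Parallel frames and flatness -/

section Flat

variable {F : Type*} [NormedAddCommGroup F] [NormedSpace ℝ F] [FiniteDimensional ℝ F]
  {M : Type*} [TopologicalSpace M] [ChartedSpace F M] [IsManifold 𝓘(ℝ, F) ∞ M]
  {γ : FormField F M} (hγ : IsRiemannianMetric γ)

include hγ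

section Pointwise

variable {p : M}

theorem metric_leviCivita_add_eq_zero {V W : VField F M} {c : ℝ}
    (hV : DiffAlongAt F (fun q : M ↦ q) V p) (hW : DiffAlongAt F (fun q : M ↦ q) W p)
    (hconst : ∀ᶠ q in 𝓝 p, γ q (V q) (W q) = c) (v : TangentSpace 𝓘(ℝ, F) p) :
    γ p (leviCivita γ V p v) (W p) + γ p (V p) (leviCivita γ W p v) = 0 := by
  have hderiv : mvfderiv 𝓘(ℝ, F) (fun q ↦ γ q (V q) (W q)) p v = 0 := by
    have hconst' : (fun q ↦ γ q (V q) (W q)) =ᶠ[𝓝 p] fun _ ↦ c := hconst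
    exact congr($(hconst'.mfderiv_eq.trans (mfderiv_const ..)) v)
  exact (mvfderiv_metric (hγ.isRegularAt p) hV hW v).symm.trans hderiv

theorem leviCivita_const_smul {V : VField F M} (hV : DiffAlongAt F (fun q : M ↦ q) V p) (c : ℝ)
    (v : TangentSpace 𝓘(ℝ, F) p) :
    leviCivita γ (fun q ↦ c • V q) p v = c • leviCivita γ V p v := by
  have hderiv : mvfderiv 𝓘(ℝ, F) (fun _ : M ↦ c) p v = 0 := congr($(mfderiv_const ..) v)
  have hsmul := covAlong_smul (hγ.isRegularAt p) (mdifferentiableAt_const (c := c)) hV v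
  rwa [hderiv, zero_smul, add_zero] at hsmul

variable {ι : Type*} [Fintype ι] {e : ι → VField F M}

theorem leviCivita_sum_smul_of_parallel (he : ∀ i, DiffAlongAt F (fun q : M ↦ q) (e i) p)
    (hparallel : ∀ i v, leviCivita γ (e i) p v = 0) {a : ι → M → ℝ}
    (ha : ∀ i, MDifferentiableAt 𝓘(ℝ, F) 𝓘(ℝ, ℝ) (a i) p) {Z : VField F M}
    (hZ : ∀ᶠ q in 𝓝 p, Z q = ∑ i, a i q • e i q) (v : TangentSpace 𝓘(ℝ, F) p) :
    leviCivita γ Z p v = ∑ i, mvfderiv 𝓘(ℝ, F) (a i) p v • e i p := by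
  have hsum := covAlong_sum_smul (φ := fun q : M ↦ q) Finset.univ (hγ.isRegularAt p)
    mdifferentiableAt_id ha he v
  rw [leviCivita, covAlong_congr hZ]
  refine hsum.trans (Finset.sum_congr rfl fun i _ ↦ ?_)
  rw [show covAlong γ (fun q : M ↦ q) (e i) p v = 0 from hparallel i v, smul_zero, zero_add]

namespace IsOrthonormalNear

variable (he : IsOrthonormalNear γ p e) (hcard : Fintype.card ι = Module.finrank ℝ F)

include he hcard

theorem eventually_leviCivita_eq_zero {i₀ : ι}
    (hparallel : ∀ᶠ q in 𝓝 p, ∀ i ≠ i₀, ∀ v, leviCivita γ (e i) q v = 0) :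
    ∀ᶠ q in 𝓝 p, ∀ i v, leviCivita γ (e i) q v = 0 := by
  filter_upwards [hparallel, he.eventually_eq_sum hcard, he.unit.eventually_nhds,
    he.orthogonal.eventually_nhds,
    Filter.eventually_all.2 fun i ↦ (he.smooth i).eventually_diffAlongAt]
    with q hq hsum hunit horth hdiff i v
  obtain hi | rfl := ne_or_eq i i₀
  · exact hq i hi v
  have hcomponent (j) : γ q (leviCivita γ (e i) q v) (e j q) = 0 := by
    obtain hj | rfl := ne_or_eq j i
    · have hadd := metric_leviCivita_add_eq_zero hγ (hdiff i) (hdiff j)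
        (horth.mono fun q' hq' ↦ hq' hj.symm) v
      rwa [hq j hj, map_zero, add_zero] at hadd
    · have hadd := metric_leviCivita_add_eq_zero hγ (hdiff j) (hdiff j)
        (hunit.mono fun q' hq' ↦ hq' j) v
      rwa [hγ.symm q (e j q), add_self_eq_zero] at hadd
  rw [hsum (leviCivita γ (e i) q v)]
  exact Finset.sum_eq_zero fun j _ ↦ by rw [hcomponent, zero_smul]

theorem curvature_eq_zero (hparallel : ∀ᶠ q in 𝓝 p, ∀ i v, leviCivita γ (e i) q v = 0)
    {X Y Z : VField F M} (hX : SmoothFieldAt X p) (hY : SmoothFieldAt Y p)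
    (hZ : SmoothFieldAt Z p) : curvature γ X Y Z p = 0 := by
  let a (i : ι) (q : M) : ℝ := γ q (Z q) (e i q)
  have ha (i) : ContMDiffAt 𝓘(ℝ, F) 𝓘(ℝ, ℝ) ∞ (a i) p := hγ.contMDiffAt_apply hZ (he.smooth i)
  have hfirst : ∀ᶠ q in 𝓝 p, ∀ v, leviCivita γ Z q v =
      ∑ i, mvfderiv 𝓘(ℝ, F) (a i) q v • e i q := by
    filter_upwards [hparallel, (he.eventually_eq_sum hcard).eventually_nhds,
      Filter.eventually_all.2 fun i ↦ (he.smooth i).eventually_diffAlongAt,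
      Filter.eventually_all.2 fun i ↦ eventually_mdifferentiableAt ((ha i).of_le ENat.LEInfty.out)]
      with q hq hsum hdiff ha_diff
    exact leviCivita_sum_smul_of_parallel hγ hdiff hq ha_diff (hsum.mono fun q' hq' ↦ hq' (Z q'))
  have hsecond {U : VField F M} (hU : SmoothFieldAt U p) (v : TangentSpace 𝓘(ℝ, F) p) :
      leviCivita γ (fun q ↦ leviCivita γ Z q (U q)) p v =
        ∑ i, mvfderiv 𝓘(ℝ, F) (fun q ↦ mvfderiv 𝓘(ℝ, F) (a i) q (U q)) p v • e i p :=
    leviCivita_sum_smul_of_parallel hγ (fun i ↦ (he.smooth i).diffAlongAt)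
      hparallel.self_of_nhds
      (fun i ↦ (contMDiffAt_mvfderiv (ha i) hU).mdifferentiableAt (by simp))
      (hfirst.mono fun q hq ↦ hq _) v
  rw [curvature, hsecond hX, hsecond hY, hfirst.self_of_nhds]
  simp only [mvfderiv_mlieBracket hX hY (ha _), sub_smul, Finset.sum_sub_distrib, sub_self]

end IsOrthonormalNear

end Pointwise

section ParallelField

variable [ConnectedSpace M] {X : VField F M} (hX : ∀ p, SmoothFieldAt X p)
  (hparallel : ∀ p v, leviCivita γ X p v = 0)

include hX hparallel

theorem metric_self_eq_of_parallel (p q : M) : γ p (X p) (X p) = γ q (X q) (X q) := by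
  refine (isLocallyConstant_of_mvfderiv_eq_zero (F := F) (f := fun p ↦ γ p (X p) (X p))
    (fun p ↦ (hγ.contMDiffAt_apply (hX p) (hX p)).mdifferentiableAt (by simp))
    fun p v ↦ ?_).apply_eq_of_isPreconnected isPreconnected_univ (mem_univ p) (mem_univ q)
  have hcov : covAlong γ (fun q : M ↦ q) X p v = 0 := hparallel p v
  rw [mvfderiv_metric (hγ.isRegularAt p) (hX p).diffAlongAt (hX p).diffAlongAt, hcov, map_zero,
    map_zero, zero_apply, add_zero]

theorem isFlat_or_eq_zero_of_parallel (hF : Module.finrank ℝ F = 2) :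
    IsFlat γ ∨ ∀ p, X p = 0 := by
  refine or_iff_not_imp_right.2 fun hne U V W hU hV hW p ↦ ?_
  obtain ⟨p₀, hp₀⟩ := not_forall.1 hne
  let c := (√(γ p₀ (X p₀) (X p₀)))⁻¹
  let e₀ : VField F M := fun q ↦ c • X q
  have he₀_unit (q) : γ q (e₀ q) (e₀ q) = 1 := by
    have hpos := hγ.pos p₀ _ hp₀
    simp only [e₀, map_smul, smul_apply, smul_eq_mul]
    rw [metric_self_eq_of_parallel hγ hX hparallel q p₀, ← mul_assoc, ← mul_inv,
      Real.mul_self_sqrt hpos.le, inv_mul_cancel₀ hpos.ne']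
  have he₀ : IsOrthonormalNear γ p fun _ : Fin 1 ↦ e₀ :=
    ⟨fun _ ↦ .smul contMDiffAt_const (hX p), .of_forall fun q _ ↦ he₀_unit q,
      .of_forall fun _ ↦ Subsingleton.pairwise⟩
  obtain ⟨e, he, he_zero⟩ := he₀.exists_extension hγ one_le_two hF.ge
  have hcard : Fintype.card (Fin 2) = Module.finrank ℝ F := hF.symm ▸ Fintype.card_fin 2
  have he_parallel : ∀ᶠ q in 𝓝 p, ∀ i ≠ (1 : Fin 2), ∀ v, leviCivita γ (e i) q v = 0 := by
    refine .of_forall fun q i hi v ↦ ?_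
    obtain rfl : i = 0 := by omega
    rw [show e 0 = e₀ from he_zero 0, leviCivita_const_smul hγ (hX q).diffAlongAt, hparallel,
      smul_zero]
  exact he.curvature_eq_zero hγ hcard (he.eventually_leviCivita_eq_zero hγ hcard he_parallel)
    (hU p) (hV p) (hW p)

end ParallelField

end Flat

/-! ## Immersed submanifolds -/

section Immersion

variable {E : Type*} [NormedAddCommGroup E] [NormedSpace ℝ E]
  {N : Type*} [TopologicalSpace N] [ChartedSpace E N]
  {F : Type*} [NormedAddCommGroup F] [NormedSpace ℝ F]
  {M : Type*} [TopologicalSpace M] [ChartedSpace F M]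
  {g : FormField E N} {φ : M → N} {p : M}

/-- `n` is a normal vector of the submanifold at `p`. -/
def IsNormalAt (F : Type*) [NormedAddCommGroup F] [NormedSpace ℝ F]
    {M : Type*} [TopologicalSpace M] [ChartedSpace F M]
    (g : FormField E N) (φ : M → N) (p : M) (n : TangentSpace 𝓘(ℝ, E) (φ p)) : Prop :=
  ∀ w : TangentSpace 𝓘(ℝ, F) p, g (φ p) n (differential E F φ p w) = 0

theorem isNormalAt_zero : IsNormalAt F g φ p 0 := fun w ↦
  congr($(map_zero (g (φ p))) (differential E F φ p w))

theorem IsNormalAt.add {n n' : TangentSpace 𝓘(ℝ, E) (φ p)} (hn : IsNormalAt F g φ p n)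
    (hn' : IsNormalAt F g φ p n') : IsNormalAt F g φ p (n + n') := fun w ↦ by
  rw [map_add, add_apply, hn, hn', add_zero]

theorem differential_tangentPart_add_normalPart (u : TangentSpace 𝓘(ℝ, E) (φ p)) :
    differential E F φ p (tangentPart F g φ p u) + normalPart F g φ p u = u :=
  add_sub_cancel _ _

section Projection

variable (hi : (formAt (inducedMetric (F := F) g φ) p).IsInvertible)

include hi

theorem metric_tangentPart (u : TangentSpace 𝓘(ℝ, E) (φ p)) (w : TangentSpace 𝓘(ℝ, F) p) :
    inducedMetric g φ p (tangentPart F g φ p u) w = g (φ p) u (differential E F φ p w) :=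
  congr($(hi.self_apply_inverse ((g (φ p) u).comp (differential E F φ p))) w)

theorem isNormalAt_normalPart (u : TangentSpace 𝓘(ℝ, E) (φ p)) :
    IsNormalAt F g φ p (normalPart F g φ p u) := fun w ↦ by
  rw [normalPart, map_sub, sub_apply, ← metric_tangentPart hi, sub_eq_zero]
  rfl

variable {t : TangentSpace 𝓘(ℝ, F) p} {n : TangentSpace 𝓘(ℝ, E) (φ p)}

theorem tangentPart_differential_add (hn : IsNormalAt F g φ p n) :
    tangentPart F g φ p (differential E F φ p t + n) = t := by
  have hform : (g (φ p) (differential E F φ p t + n)).comp (differential E F φ p) =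
      inducedMetric (F := F) g φ p t := by
    ext w
    rw [ContinuousLinearMap.comp_apply, map_add, add_apply, hn, add_zero]
    rfl
  exact congr((formAt (inducedMetric (F := F) g φ) p).inverse $hform).trans
    (hi.inverse_apply_self t)

theorem normalPart_differential_add (hn : IsNormalAt F g φ p n) :
    normalPart F g φ p (differential E F φ p t + n) = n := by
  rw [normalPart, tangentPart_differential_add hi hn, add_sub_cancel_left]

theorem normalPart_eq_zero_iff {u : TangentSpace 𝓘(ℝ, E) (φ p)} :
    normalPart F g φ p u = 0 ↔ u ∈ LinearMap.range (differential E F φ p).toLinearMap := by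
  refine ⟨fun hu ↦ ⟨tangentPart F g φ p u, (sub_eq_zero.1 hu).symm⟩, ?_⟩
  rintro ⟨t, rfl⟩
  have hnormal := normalPart_differential_add hi (t := t) isNormalAt_zero
  rwa [add_zero] at hnormal

end Projection

section SecondFundamentalForm

variable [IsManifold 𝓘(ℝ, E) ∞ N] [IsManifold 𝓘(ℝ, F) ∞ M]

theorem covAlong_differential_eq_add_gaussForm (hφ : ContMDiffAt 𝓘(ℝ, F) 𝓘(ℝ, E) ∞ φ p)
    {Y : VField F M} (hY : DiffAlongAt F (fun p : M ↦ p) Y p) (v : TangentSpace 𝓘(ℝ, F) p) :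
    covAlong g φ (fun p' ↦ differential E F φ p' (Y p')) p v =
      differential E F φ p (leviCivita (inducedMetric g φ) Y p v)
        + gaussForm F g φ p v (Y p) := by
  have hcov := covAlong_differential (φ := fun p : M ↦ p) g
    (hφ.of_le ENat.LEInfty.out) hY v
  have hid : differential F F (fun p : M ↦ p) p v = v :=
    congr($(mfderiv_id (I := 𝓘(ℝ, F)) (x := p)) v)
  rwa [hid] at hcov

theorem isNormalAt_secondFundamentalForm
    (hi : (formAt (inducedMetric (F := F) g φ) p).IsInvertible) (v w : TangentSpace 𝓘(ℝ, F) p) :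
    IsNormalAt F g φ p (secondFundamentalForm g φ p v w) :=
  isNormalAt_normalPart hi _

variable [FiniteDimensional ℝ E] [FiniteDimensional ℝ F]
  (hg : IsRiemannianMetric g) (hφ : IsSmoothImmersion E F φ)

include hg hφ

theorem secondFundamentalForm_eq_gaussForm (v w : TangentSpace 𝓘(ℝ, F) p) :
    secondFundamentalForm g φ p v w = gaussForm F g φ p v w := by
  have hi := (hg.induced hφ).isInvertible p
  have hdiff : DiffAlongAt F (fun p : M ↦ p) (fun p' : M ↦ FiberBundle.extend F w p') p :=
    FiberBundle.mdifferentiableAt_extend 𝓘(ℝ, F) F w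
  rw [secondFundamentalForm, covAlong_differential_eq_add_gaussForm (hφ.1 p) hdiff,
    FiberBundle.extend_apply_self]
  exact normalPart_differential_add hi
    (metric_gaussForm (hg.isRegularAt _) hi ((hφ.1 p).of_le ENat.LEInfty.out) v w)

theorem gauss_formula {Y : VField F M} (hY : DiffAlongAt F (fun p : M ↦ p) Y p)
    (v : TangentSpace 𝓘(ℝ, F) p) :
    covAlong g φ (fun p' ↦ differential E F φ p' (Y p')) p v =
      differential E F φ p (leviCivita (inducedMetric g φ) Y p v)
        + secondFundamentalForm g φ p v (Y p) := by
  rw [secondFundamentalForm_eq_gaussForm hg hφ]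
  exact covAlong_differential_eq_add_gaussForm (hφ.1 p) hY v

theorem secondFundamentalForm_comm (v w : TangentSpace 𝓘(ℝ, F) p) :
    secondFundamentalForm g φ p v w = secondFundamentalForm g φ p w v := by
  rw [secondFundamentalForm_eq_gaussForm hg hφ, secondFundamentalForm_eq_gaussForm hg hφ]
  exact gaussForm_comm (hg.isRegularAt _) ((hg.induced hφ).isInvertible p)
    ((hφ.1 p).of_le ENat.LEInfty.out) v w

theorem secondFundamentalForm_add_left (v v' w : TangentSpace 𝓘(ℝ, F) p) :
    secondFundamentalForm g φ p (v + v') w =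
      secondFundamentalForm g φ p v w + secondFundamentalForm g φ p v' w := by
  simp only [secondFundamentalForm_eq_gaussForm hg hφ]
  exact gaussForm_add_left (hg.isRegularAt _) ((hg.induced hφ).isInvertible p)
    ((hφ.1 p).of_le ENat.LEInfty.out) v v' w

theorem secondFundamentalForm_smul_left (c : ℝ) (v w : TangentSpace 𝓘(ℝ, F) p) :
    secondFundamentalForm g φ p (c • v) w = c • secondFundamentalForm g φ p v w := by
  simp only [secondFundamentalForm_eq_gaussForm hg hφ]
  exact gaussForm_smul_left (hg.isRegularAt _) ((hg.induced hφ).isInvertible p)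
    ((hφ.1 p).of_le ENat.LEInfty.out) c v w

theorem secondFundamentalForm_add_right (v w w' : TangentSpace 𝓘(ℝ, F) p) :
    secondFundamentalForm g φ p v (w + w') =
      secondFundamentalForm g φ p v w + secondFundamentalForm g φ p v w' := by
  rw [secondFundamentalForm_comm hg hφ, secondFundamentalForm_add_left hg hφ,
    secondFundamentalForm_comm hg hφ w, secondFundamentalForm_comm hg hφ w']

theorem secondFundamentalForm_smul_right (c : ℝ) (v w : TangentSpace 𝓘(ℝ, F) p) :
    secondFundamentalForm g φ p v (c • w) = c • secondFundamentalForm g φ p v w := by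
  rw [secondFundamentalForm_comm hg hφ, secondFundamentalForm_smul_left hg hφ,
    secondFundamentalForm_comm hg hφ w]

theorem meanCurvature_eq_sum {ι : Type*} [Fintype ι] {e : ι → TangentSpace 𝓘(ℝ, F) p}
    (he : ∀ i, inducedMetric g φ p (e i) (e i) = 1)
    (horth : Pairwise fun i j ↦ inducedMetric g φ p (e i) (e j) = 0)
    (hcard : Fintype.card ι = Module.finrank ℝ F) :
    meanCurvature F g φ p =
      (Module.finrank ℝ F : ℝ)⁻¹ • ∑ i, secondFundamentalForm g φ p (e i) (e i) := by
  let σ : F →ₗ[ℝ] F →ₗ[ℝ] E := LinearMap.mk₂ ℝ (fun v w ↦ secondFundamentalForm g φ p v w)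
    (secondFundamentalForm_add_left hg hφ) (secondFundamentalForm_smul_left hg hφ)
    (secondFundamentalForm_add_right hg hφ) (secondFundamentalForm_smul_right hg hφ)
  have htrace := sum_apply_inverse_coord (E := F) (B := formAt (inducedMetric g φ) p) he horth
    hcard ((hg.induced hφ).isInvertible p) (Module.finBasis ℝ F) σ
  exact congr((Module.finrank ℝ F : ℝ)⁻¹ • $htrace)

end SecondFundamentalForm

end Immersion

/-! ## Totally real submanifolds of Kähler manifolds -/

namespace KahlerStructure

variable {E : Type*} [NormedAddCommGroup E] [NormedSpace ℝ E]
  {N : Type*} [TopologicalSpace N] [ChartedSpace E N] [IsManifold 𝓘(ℝ, E) ∞ N]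
  (K : KahlerStructure E N)
  {F : Type*} [NormedAddCommGroup F] [NormedSpace ℝ F]
  {M : Type*} [TopologicalSpace M] [ChartedSpace F M] {φ : M → N} {p : M}

theorem metric_J_left (q : N) (v w : TangentSpace 𝓘(ℝ, E) q) :
    K.g q (K.J q v) w = -K.g q v (K.J q w) := by
  rw [← K.metric_J q v, K.J_J, map_neg, neg_neg]

theorem J_injective (q : N) : Function.Injective (K.J q) := fun v w h ↦ by
  rw [← neg_inj, ← K.J_J, ← K.J_J, h]

theorem isRiemannianMetric [FiniteDimensional ℝ E] : IsRiemannianMetric K.g where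
  symm := K.metric.symm
  pos := K.metric.pos
  contDiffOn_chartForm := contDiffOn_chartForm_of_contMDiffAt fun X Y q hX hY ↦ by
    have hbundle : ContMDiffAt 𝓘(ℝ, E) (𝓘(ℝ, E).prod 𝓘(ℝ, ℝ)) ∞
        (fun q' ↦ TotalSpace.mk' ℝ (E := Bundle.Trivial N ℝ) q' (K.g q' (X q') (Y q'))) q :=
      ContMDiffAt.clm_bundle_apply₂ (F₁ := E) (F₂ := E) (K.metric.contMDiff q) hX hY
    exact (contMDiffAt_totalSpace.1 hbundle).2

theorem smoothAlongAt_J {s : ∀ p : M, TangentSpace 𝓘(ℝ, E) (φ p)} (hs : SmoothAlongAt F φ s p) :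
    SmoothAlongAt F φ (fun p' ↦ K.J (φ p') (s p')) p :=
  ContMDiffAt.clm_bundle_apply (ContMDiffAt.comp p (K.smooth_J (φ p)) hs.contMDiffAt) hs

theorem covAlong_J [FiniteDimensional ℝ E] [T2Space N] {s : ∀ p : M, TangentSpace 𝓘(ℝ, E) (φ p)}
    (hs : DiffAlongAt F φ s p) (v : TangentSpace 𝓘(ℝ, F) p) :
    covAlong K.g φ (fun p' ↦ K.J (φ p') (s p')) p v = K.J (φ p) (covAlong K.g φ s p v) :=
  covAlong_endomorphism (fun _ hX ↦ ContMDiff.clm_bundle_apply K.smooth_J hX) K.parallel_J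
    (K.isRiemannianMetric.isRegularAt _) hs v

/-- The tangent field `X` with `H = J X` where `f H = 0`: the tangential part of `-J H`. -/
def meanCurvatureField (F : Type*) [NormedAddCommGroup F] [NormedSpace ℝ F]
    [FiniteDimensional ℝ F] {M : Type*} [TopologicalSpace M] [ChartedSpace F M]
    [IsManifold 𝓘(ℝ, F) ∞ M] (φ : M → N) : VField F M :=
  fun p ↦ tangentPart F K.g φ p (-K.J (φ p) (meanCurvature F K.g φ p))

section Pointwise

variable {K}

theorem metric_f_of_isNormalAt {ξ η : TangentSpace 𝓘(ℝ, E) (φ p)} (hη : IsNormalAt F K.g φ p η) :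
    K.g (φ p) (K.f F φ p ξ) η = K.g (φ p) (K.J (φ p) ξ) η := by
  rw [f, normalPart, map_sub, sub_apply, K.metric.symm (φ p) (differential E F φ p _), hη, sub_zero]

theorem metric_f_left {ξ η : TangentSpace 𝓘(ℝ, E) (φ p)} (hξ : IsNormalAt F K.g φ p ξ)
    (hη : IsNormalAt F K.g φ p η) :
    K.g (φ p) (K.f F φ p ξ) η = -K.g (φ p) ξ (K.f F φ p η) := by
  rw [metric_f_of_isNormalAt hη, K.metric_J_left, K.metric.symm _ ξ, K.metric.symm _ ξ,
    metric_f_of_isNormalAt hξ]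

variable (hi : (formAt (inducedMetric (F := F) K.g φ) p).IsInvertible)

include hi

theorem f_J_differential_add (u : TangentSpace 𝓘(ℝ, F) p) (ξ : TangentSpace 𝓘(ℝ, E) (φ p)) :
    K.f F φ p (K.J (φ p) (differential E F φ p u) + ξ) = K.f F φ p ξ := by
  have hdecomp : K.J (φ p) (K.J (φ p) (differential E F φ p u) + ξ) =
      differential E F φ p (-u + tangentPart F K.g φ p (K.J (φ p) ξ)) + K.f F φ p ξ := by
    rw [map_add, K.J_J, map_add, map_neg, add_assoc, f, differential_tangentPart_add_normalPart]
  rw [f, hdecomp]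
  exact normalPart_differential_add hi (isNormalAt_normalPart hi _)

theorem f_J_differential (u : TangentSpace 𝓘(ℝ, F) p) :
    K.f F φ p (K.J (φ p) (differential E F φ p u)) = 0 := by
  rw [f, normalPart_eq_zero_iff hi]
  exact ⟨-u, by rw [K.J_J]; exact map_neg _ u⟩

theorem f_eq_zero_of_f_f_eq_zero {ξ : TangentSpace 𝓘(ℝ, E) (φ p)} (hξ : IsNormalAt F K.g φ p ξ)
    (hff : K.f F φ p (K.f F φ p ξ) = 0) : K.f F φ p ξ = 0 := by
  by_contra hne
  refine (K.metric.pos (φ p) _ hne).ne' ?_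
  have hfξ : IsNormalAt F K.g φ p (K.f F φ p ξ) := isNormalAt_normalPart hi _
  exact (metric_f_left hξ hfξ).trans (by rw [hff, map_zero, neg_zero])

end Pointwise

variable [FiniteDimensional ℝ E] [FiniteDimensional ℝ F] [IsManifold 𝓘(ℝ, F) ∞ M]
  {K} (hφ : IsSmoothImmersion E F φ) (hreal : K.IsTotallyReal F φ)

include hφ

theorem isInvertible_inducedMetric (p : M) :
    (formAt (inducedMetric (F := F) K.g φ) p).IsInvertible :=
  (K.isRiemannianMetric.induced hφ).isInvertible p

include hreal

theorem normalCov_J_differential [T2Space N] {Z : VField F M} (hZ : SmoothFieldAt Z p)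
    (v : TangentSpace 𝓘(ℝ, F) p) :
    normalCov K.g φ (fun p' ↦ K.J (φ p') (differential E F φ p' (Z p'))) p v =
      K.J (φ p) (differential E F φ p (leviCivita (inducedMetric K.g φ) Z p v))
        + K.f F φ p (secondFundamentalForm K.g φ p v (Z p)) := by
  have hi := isInvertible_inducedMetric (K := K) hφ p
  let u := leviCivita (inducedMetric K.g φ) Z p v
  let σ := secondFundamentalForm K.g φ p v (Z p)
  have hcov : covAlong K.g φ (fun p' ↦ K.J (φ p') (differential E F φ p' (Z p'))) p v =
      differential E F φ p (tangentPart F K.g φ p (K.J (φ p) σ))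
        + (K.J (φ p) (differential E F φ p u) + K.f F φ p σ) := by
    rw [K.covAlong_J (smoothAlongAt_differential (hφ.1 p) hZ).diffAlongAt,
      gauss_formula K.isRiemannianMetric hφ hZ.diffAlongAt, map_add, add_left_comm, f,
      differential_tangentPart_add_normalPart]
  rw [normalCov, hcov]
  exact normalPart_differential_add hi
    (IsNormalAt.add (fun w ↦ hreal p u w) (isNormalAt_normalPart hi _))

section ParallelF

variable [T2Space N] [T2Space M] (hf : K.HasParallelF F φ)

include hf

theorem f_secondFundamentalForm_eq_zero (v w : TangentSpace 𝓘(ℝ, F) p) :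
    K.f F φ p (secondFundamentalForm K.g φ p v w) = 0 := by
  have hi (p : M) := isInvertible_inducedMetric (K := K) hφ p
  obtain ⟨Z, hZ, hZ_eq⟩ := exists_smoothField_eventuallyEq_ofCoord (E := F) p w
  have hZp : Z p = w := hZ_eq.self_of_nhds.trans (ofCoord_self (E := F) p w)
  let ξ : ∀ p : M, TangentSpace 𝓘(ℝ, E) (φ p) := fun p ↦ K.J (φ p) (differential E F φ p (Z p))
  have hξ : IsNormalField F K.g φ ξ :=
    ⟨fun p ↦ K.smoothAlongAt_J (smoothAlongAt_differential (hφ.1 p) (hZ p)),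
      fun p w ↦ hreal p (Z p) w⟩
  have hfξ : (fun p ↦ K.f F φ p (ξ p)) = fun p ↦ (0 : TangentSpace 𝓘(ℝ, E) (φ p)) :=
    funext fun p ↦ f_J_differential (hi p) (Z p)
  have hDfξ : normalCov K.g φ (fun p ↦ K.f F φ p (ξ p)) p v = 0 := by
    rw [hfξ, normalCov, covAlong_zero (K.isRiemannianMetric.isRegularAt _)
      ((hφ.1 p).mdifferentiableAt (by simp)), normalPart_eq_zero_iff (hi p)]
    exact zero_mem _
  refine f_eq_zero_of_f_f_eq_zero (hi p) (isNormalAt_secondFundamentalForm (hi p) v w) ?_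
  calc K.f F φ p (K.f F φ p (secondFundamentalForm K.g φ p v w))
      = K.f F φ p (normalCov K.g φ ξ p v) := by
        rw [normalCov_J_differential hφ hreal (hZ p), f_J_differential_add (hi p), hZp]
    _ = 0 := (hf ξ hξ p v).symm.trans hDfξ

theorem f_meanCurvature_eq_zero (p : M) : K.f F φ p (meanCurvature F K.g φ p) = 0 := by
  have hi := isInvertible_inducedMetric (K := K) hφ p
  have hJσ (v w : TangentSpace 𝓘(ℝ, F) p) : K.J (φ p) (secondFundamentalForm K.g φ p v w) ∈
      LinearMap.range (differential E F φ p).toLinearMap :=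
    (normalPart_eq_zero_iff hi).1 (f_secondFundamentalForm_eq_zero hφ hreal hf v w)
  rw [f, normalPart_eq_zero_iff hi, meanCurvature, map_smul, map_sum]
  exact Submodule.smul_mem _ _ (Submodule.sum_mem _ fun i _ ↦ hJσ _ _)

end ParallelF

section MeanCurvature

omit [FiniteDimensional ℝ E] hφ hreal in
theorem metric_meanCurvatureField (hi : (formAt (inducedMetric (F := F) K.g φ) p).IsInvertible)
    (w : TangentSpace 𝓘(ℝ, F) p) :
    inducedMetric K.g φ p (K.meanCurvatureField F φ p) w =
      K.g (φ p) (meanCurvature F K.g φ p) (K.J (φ p) (differential E F φ p w)) := by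
  rw [meanCurvatureField, metric_tangentPart hi, map_neg, neg_apply, K.metric_J_left, neg_neg]

theorem metric_secondFundamentalForm_J {Y : VField F M}
    (hY : DiffAlongAt F (fun p : M ↦ p) Y p) (v w : TangentSpace 𝓘(ℝ, F) p) :
    K.g (φ p) (secondFundamentalForm K.g φ p v (Y p)) (K.J (φ p) (differential E F φ p w)) =
      K.g (φ p) (covAlong K.g φ (fun p' ↦ differential E F φ p' (Y p')) p v)
        (K.J (φ p) (differential E F φ p w)) := by
  rw [gauss_formula K.isRiemannianMetric hφ hY, map_add, add_apply,
    K.metric.symm _ (differential E F φ p _), hreal, zero_add]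

theorem smoothFieldAt_meanCurvatureField (p : M) :
    SmoothFieldAt (K.meanCurvatureField F φ) p := by
  have hg := K.isRiemannianMetric
  obtain ⟨e, he⟩ := (hg.induced hφ).exists_isOrthonormalNear p
  have hcard : Fintype.card (Fin (Module.finrank ℝ F)) = Module.finrank ℝ F := Fintype.card_fin _
  have hde (i) := smoothAlongAt_differential (hφ.1 p) (he.smooth i)
  have hcoeff (i) : ContMDiffAt 𝓘(ℝ, F) 𝓘(ℝ, ℝ) ∞
      (fun q ↦ inducedMetric K.g φ q (K.meanCurvatureField F φ q) (e i q)) p := by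
    have hsum : ContMDiffAt 𝓘(ℝ, F) 𝓘(ℝ, ℝ) ∞ (fun q ↦ (Module.finrank ℝ F : ℝ)⁻¹ *
        ∑ j, K.g (φ q) (covAlong K.g φ (fun q' ↦ differential E F φ q' (e j q')) q (e j q))
          (K.J (φ q) (differential E F φ q (e i q)))) p :=
      contMDiffAt_const.mul <| contMDiffAt_finsetSum fun j _ ↦
        contMDiffAt_metric_covAlong hg (he.smooth j) (hde j) (K.smoothAlongAt_J (hde i))
    refine hsum.congr_of_eventuallyEq ?_
    filter_upwards [he.unit, he.orthogonal,
      Filter.eventually_all.2 fun j ↦ (he.smooth j).eventually_diffAlongAt] with q hunit horth hdiff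
    rw [metric_meanCurvatureField (isInvertible_inducedMetric hφ q),
      meanCurvature_eq_sum hg hφ hunit horth hcard, map_smul, map_sum, smul_apply, sum_apply,
      smul_eq_mul]
    simp only [metric_secondFundamentalForm_J hφ hreal (hdiff _)]
  have hsmooth : SmoothFieldAt (fun q ↦ ∑ i, inducedMetric K.g φ q (K.meanCurvatureField F φ q)
      (e i q) • e i q) p := ContMDiffAt.sum_section fun i _ ↦ (he.smooth i).smul (hcoeff i)
  exact hsmooth.congr ((he.eventually_eq_sum hcard).mono fun q hq ↦ hq _)

variable [T2Space N] [T2Space M] (hf : K.HasParallelF F φ)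

include hf

theorem J_differential_meanCurvatureField (p : M) :
    K.J (φ p) (differential E F φ p (K.meanCurvatureField F φ p)) = meanCurvature F K.g φ p := by
  have hi := isInvertible_inducedMetric (K := K) hφ p
  have hnormal : normalPart F K.g φ p (-K.J (φ p) (meanCurvature F K.g φ p)) = 0 :=
    (normalPart_eq_zero_iff hi).2
      (neg_mem ((normalPart_eq_zero_iff hi).1 (f_meanCurvature_eq_zero hφ hreal hf p)))
  have hX : differential E F φ p (K.meanCurvatureField F φ p) =
      -K.J (φ p) (meanCurvature F K.g φ p) :=
    left_eq_add.2 hnormal |>.trans (differential_tangentPart_add_normalPart _)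
  rw [hX, map_neg, K.J_J, neg_neg]

theorem leviCivita_meanCurvatureField_eq_zero
    (hH : IsNormalParallel F K.g φ (meanCurvature F K.g φ)) (p : M) (v : TangentSpace 𝓘(ℝ, F) p) :
    leviCivita (inducedMetric K.g φ) (K.meanCurvatureField F φ) p v = 0 := by
  have hJX : (fun p' ↦ K.J (φ p') (differential E F φ p' (K.meanCurvatureField F φ p'))) =
      meanCurvature F K.g φ := funext (J_differential_meanCurvatureField hφ hreal hf)
  have hD := normalCov_J_differential hφ hreal (smoothFieldAt_meanCurvatureField hφ hreal p) v
  rw [hJX, hH p v, f_secondFundamentalForm_eq_zero hφ hreal hf, add_zero] at hD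
  refine hφ.2 p (K.J_injective _ ?_)
  rw [← hD, map_zero, map_zero]

end MeanCurvature

end KahlerStructure

end TotallyReal

end

theorem proposition5_general {E F : Type*} [NormedAddCommGroup E] [NormedSpace ℝ E]
    [FiniteDimensional ℝ E] [NormedAddCommGroup F] [NormedSpace ℝ F] [FiniteDimensional ℝ F]
    (hF : Module.finrank ℝ F = 2)
    {N : Type*} [TopologicalSpace N] [T2Space N] [ChartedSpace E N] [IsManifold 𝓘(ℝ, E) ∞ N]
    (K : TotallyReal.KahlerStructure E N)
    {M : Type*} [TopologicalSpace M] [T2Space M] [ConnectedSpace M] [ChartedSpace F M]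
    [IsManifold 𝓘(ℝ, F) ∞ M] {φ : M → N} (hφ : TotallyReal.IsSmoothImmersion E F φ)
    (hreal : K.IsTotallyReal F φ) (hf : K.HasParallelF F φ)
    (hH : TotallyReal.IsNormalParallel F K.g φ (TotallyReal.meanCurvature F K.g φ)) :
    TotallyReal.IsFlat (TotallyReal.inducedMetric (F := F) K.g φ) ∨
      TotallyReal.IsMinimal F K.g φ := by
  have hX := TotallyReal.KahlerStructure.smoothFieldAt_meanCurvatureField hφ hreal
  have hX_parallel :=
    TotallyReal.KahlerStructure.leviCivita_meanCurvatureField_eq_zero hφ hreal hf hH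
  have hJX := TotallyReal.KahlerStructure.J_differential_meanCurvatureField hφ hreal hf
  refine (TotallyReal.isFlat_or_eq_zero_of_parallel (K.isRiemannianMetric.induced hφ) hX
    hX_parallel hF).imp_right fun hzero p ↦ ?_
  rw [← hJX, hzero, map_zero, map_zero]

theorem proposition5 {m : ℕ}
    {N : Type*} [TopologicalSpace N] [T2Space N]
    [ChartedSpace (EuclideanSpace ℝ (Fin (2 * m))) N]
    [IsManifold 𝓘(ℝ, EuclideanSpace ℝ (Fin (2 * m))) ∞ N]
    (K : TotallyReal.KahlerStructure (EuclideanSpace ℝ (Fin (2 * m))) N)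
    {M : Type*} [TopologicalSpace M] [T2Space M] [ConnectedSpace M]
    [ChartedSpace (EuclideanSpace ℝ (Fin 2)) M]
    [IsManifold 𝓘(ℝ, EuclideanSpace ℝ (Fin 2)) ∞ M]
    (φ : M → N)
    (hφ : TotallyReal.IsSmoothImmersion
      (EuclideanSpace ℝ (Fin (2 * m))) (EuclideanSpace ℝ (Fin 2)) φ)
    (hreal : K.IsTotallyReal (EuclideanSpace ℝ (Fin 2)) φ)
    (hf : K.HasParallelF (EuclideanSpace ℝ (Fin 2)) φ)
    (hH : TotallyReal.IsNormalParallel (EuclideanSpace ℝ (Fin 2)) K.g φ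
      (TotallyReal.meanCurvature (EuclideanSpace ℝ (Fin 2)) K.g φ)) :
    TotallyReal.IsFlat
        (TotallyReal.inducedMetric (F := EuclideanSpace ℝ (Fin 2)) K.g φ) ∨
      TotallyReal.IsMinimal (EuclideanSpace ℝ (Fin 2)) K.g φ := by
  exact proposition5_general (by simp) K hφ hreal hf hH
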